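/- Let $K$ be a field of characteristic $0$ and let $k\ge 1$. Let the Magnus commutator $\mu_k(X_1,\dots,X_k)$ be the noncommutative polynomial over $K$ that is the coefficient of $t_1\cdots t_k$ in the formal series $\log(\exp(t_1X_1)\cdots\exp(t_kX_k))$ with commuting central variables $t_i$. Let $\mathfrak M_k$ be the vector space spanned by the noncommutative monomials in which each of $X_1,\dots,X_k$ occurs exactly once, and define linear maps $^\dagger$, $^\curvearrowright$ on $\mathfrak M_k$ by $$(X_{i_1}\cdots X_{i_k})^\dagger=(-1)^{k+1}X_{k+1-i_1}\cdots X_{k+1-i_k},$$ $$(X_{i_1}\cdots X_{i_{s-1}}X_kX_{i_{s+1}}\cdots X_{i_k})^\curvearrowright=X_{i_{s+1}+1}\cdots X_{i_k+1}\,X_1\,X_{i_1+1}\cdots X_{i_{s-1}+1}.$$ Let $\mathfrak M_k^{\mathrm{Lie}}$ be the subspace of the free Lie algebra on $X_1,\dots,X_k$ spanned by the Lie monomials (iterated brackets, and their negatives) in which each $X_i$ occurs exactly once. Let $\mathfrak M_k^{\mathrm{Lie}}\to\mathfrak M_k$ be the natural map that takes brackets to commutators. Let $\mathrm{Tr}$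 be the formal trace, i.e. the linear map that sends each monomial to its cyclic word. Then the following hold. 1. (Reflection) $\mu_k(X_1,\dots,X_k)=-\mu_k(-X_k,\dots,-X_1)$. 2. (Cyclic symmetry) $\mathrm{Tr}\,X_0\,\mu_k(X_1,\dots,X_k)=\mathrm{Tr}\,\mu_k(X_0,\dots,X_{k-1})\,X_k$ in the variables $X_0,\dots,X_k$. 3. (Dihedral action) There is a linear action on $\mathfrak M_k$ of the dihedral group $D_{2(k+1)}$ of order $2(k+1)$ in which the generating rotation acts as $^\curvearrowright$ and a reflection acts as $^\dagger$. The natural map $\mathfrak M_k^{\mathrm{Lie}}\to\mathfrak M_k$ is injective, and the action descends to a linear action on $\mathfrak M_k^{\mathrm{Lie}}$ (compatible with this map) that takes Lie monomials to Lie monomials. 4. (Invariance) There is a (necessarily unique) Lie polynomial $\mu_k^{\mathrm{Lie}}\in\mathfrak M_k^{\mathrm{Lie}}$ whose image in $\mathfrak M_k$ is $\mu_k(X_1,\dots,X_k)$, and it is invariant under $^\dagger$ and $^\curvearrowright$, hence under the whole dihedral action. -/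

import Mathlib

namespace Magnus

/-! ### Formal exponential and logarithm, and the Magnus commutators -/

section Series

variable (K : Type*) [Field K] {A : Type*} [Ring A] [Algebra K A] {σ : Type*}

/-- `exp F = ∑ m, F ^ m / m!` in the ring `A⟦t_i : i ∈ σ⟧` (central commuting variables `t_i`,
possibly noncommutative coefficients), for a series `F` without constant term: the coefficient of
degree `d` only receives contributions from `m ≤ |d|`. -/
noncomputable def expSeries (F : MvPowerSeries σ A) : MvPowerSeries σ A := fun d =>
  ∑ m ∈ Finset.range (d.degree + 1), ((m.factorial : K)⁻¹) • MvPowerSeries.coeff d (F ^ m)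

/-- `log F = ∑ m ≥ 1, (-1) ^ (m + 1) (F - 1) ^ m / m` in `A⟦t_i : i ∈ σ⟧`, for a series `F` with
constant term `1`: the coefficient of degree `d` only receives contributions from `m ≤ |d|`. -/
noncomputable def logSeries (F : MvPowerSeries σ A) : MvPowerSeries σ A := fun d =>
  ∑ m ∈ Finset.Icc 1 d.degree,
    ((-1 : K) ^ (m + 1) * (m : K)⁻¹) • MvPowerSeries.coeff d ((F - 1) ^ m)

end Series

variable (K : Type*) [Field K]

/-- The noncommutative polynomial `μ_k(X_1, …, X_k)`: the coefficient of `t_1 ⋯ t_k` in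
`log (exp (t_1 X_1) ⋯ exp (t_k X_k))`, i.e. its derivative `∂^k / ∂t_1 ⋯ ∂t_k` at `t = 0`.
The variable `X_{i+1}` is `FreeAlgebra.ι K i`, `i : Fin k`. -/
noncomputable def magnusPoly (k : ℕ) : FreeAlgebra K (Fin k) :=
  MvPowerSeries.coeff (Finsupp.equivFunOnFinite.symm fun _ : Fin k => 1)
    (logSeries K
      (List.ofFn fun i : Fin k =>
        expSeries K (MvPowerSeries.monomial (Finsupp.single i 1) (FreeAlgebra.ι K i))).prod)

/-- The value `μ_k(a_1, …, a_k)` of the Magnus commutator at elements of an algebra. -/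
noncomputable def magnus {A : Type*} [Ring A] [Algebra K A] {k : ℕ} (a : Fin k → A) : A :=
  FreeAlgebra.lift K a (magnusPoly K k)

/-! ### Words, linear maps given on words, the formal trace -/

/-- The monomial `X_{i_1} ⋯ X_{i_s}`. -/
noncomputable def word {X : Type*} (w : List X) : FreeAlgebra K X :=
  (w.map (FreeAlgebra.ι K)).prod

/-- The linear map on noncommutative polynomials with prescribed values on the monomials. -/
noncomputable def onWords {X V : Type*} [AddCommGroup V] [Module K V] (f : List X → V) :
    FreeAlgebra K X →ₗ[K] V :=
  (FreeAlgebra.basisFreeMonoid K X).constr K fun w => f w.toList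

theorem basis_eq_word {X : Type*} (w : List X) :
    FreeAlgebra.basisFreeMonoid K X (FreeMonoid.ofList w) = word K w := by
  simp only [FreeAlgebra.basisFreeMonoid, Module.Basis.map_apply, word]
  have h : ∀ v : List X, FreeAlgebra.equivMonoidAlgebraFreeMonoid
      (v.map (FreeAlgebra.ι K)).prod = MonoidAlgebra.single (FreeMonoid.ofList v) (1 : K) := by
    intro v
    induction v with
    | nil => simp [MonoidAlgebra.one_def]
    | cons x v ih =>
      rw [List.map_cons, List.prod_cons, map_mul, ih]
      simp [FreeAlgebra.equivMonoidAlgebraFreeMonoid, MonoidAlgebra.single_mul_single]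
  rw [LinearEquiv.symm_apply_eq]
  simp [h]

theorem onWords_word {X V : Type*} [AddCommGroup V] [Module K V] (f : List X → V) (w : List X) :
    onWords K f (word K w) = f w := by
  rw [← basis_eq_word, onWords, Module.Basis.constr_basis, FreeMonoid.toList_ofList]

/-- The formal trace: it takes `X_{i_1} ⋯ X_{i_s}` to the cyclic word `⟨X_{i_1} ⋯ X_{i_s}⟩` (a list
up to rotation), with values in the vector space freely spanned by the cyclic words. -/
noncomputable def formalTrace (X : Type*) : FreeAlgebra K X →ₗ[K] (Cycle X →₀ K) :=
  onWords K fun w => Finsupp.single (w : Cycle X) 1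

/-! ### Multilinear polynomials and the two operations on them -/

/-- The space `𝔐_k` spanned by the monomials in which each of `X_1, …, X_k` occurs exactly once. -/
def multilinear (k : ℕ) : Submodule K (FreeAlgebra K (Fin k)) :=
  Submodule.span K {p | ∃ w : List (Fin k), w.Perm (List.finRange k) ∧ p = word K w}

theorem perm_of_map {k : ℕ} (e : Equiv.Perm (Fin k)) {w : List (Fin k)}
    (hw : w.Perm (List.finRange k)) : (w.map e).Perm (List.finRange k) := by
  refine (hw.map e).trans ?_
  rw [List.perm_ext_iff_of_nodup ((List.nodup_finRange k).map e.injective) (List.nodup_finRange k)]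
  intro a
  simp only [List.mem_map, List.mem_finRange, true_and, iff_true]
  exact e.surjective a

/-- `M ↦ M†`: `(X_{i_1} ⋯ X_{i_k})† = (-1) ^ (k + 1) X_{k+1-i_1} ⋯ X_{k+1-i_k}`. -/
noncomputable def daggerAux (k : ℕ) : FreeAlgebra K (Fin k) →ₗ[K] FreeAlgebra K (Fin k) :=
  onWords K fun w => (-1 : K) ^ (k + 1) • word K (w.map Fin.rev)

theorem daggerAux_mem (k : ℕ) : ∀ p ∈ multilinear K k, daggerAux K k p ∈ multilinear K k := by
  intro p hp
  refine Submodule.span_induction (p := fun p _ => daggerAux K k p ∈ multilinear K k)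
    ?_ (by simp) (fun x y _ _ hx hy => by rw [map_add]; exact add_mem hx hy)
    (fun c x _ hx => by rw [map_smul]; exact Submodule.smul_mem _ c hx) hp
  rintro _ ⟨w, hw, rfl⟩
  rw [daggerAux, onWords_word]
  exact Submodule.smul_mem _ _ (Submodule.subset_span ⟨_, perm_of_map Fin.revPerm hw, rfl⟩)

/-- The reflection `†` on `𝔐_k`. -/
noncomputable def dagger (k : ℕ) : multilinear K k →ₗ[K] multilinear K k :=
  (daggerAux K k).restrict (daggerAux_mem K k)

/-- On indices, the rotation sends a word `u k v`, with `k` not occurring in `u`, to the word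
`(v + 1) 1 (u + 1)`. As elements of `Fin k`, the index `k` is `⊤` and the index `1` is `0`. -/
def rotateWord {k : ℕ} [NeZero k] (w : List (Fin k)) : List (Fin k) :=
  (w.dropWhile fun i => i ≠ ⊤).tail.map (· + 1) ++ 0 :: (w.takeWhile fun i => i ≠ ⊤).map (· + 1)

theorem rotateWord_eq {k : ℕ} [NeZero k] (u v : List (Fin k)) (hu : (⊤ : Fin k) ∉ u) :
    rotateWord (u ++ ⊤ :: v) = v.map (· + 1) ++ 0 :: u.map (· + 1) := by
  have h : ∀ a ∈ u, decide (a ≠ ⊤) = true := fun a ha => by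
    simp only [decide_eq_true_eq]; rintro rfl; exact hu ha
  simp only [rotateWord, List.dropWhile_append_of_pos h, List.takeWhile_append_of_pos h]
  simp

theorem rotateWord_perm {k : ℕ} [NeZero k] {w : List (Fin k)} (hw : w.Perm (List.finRange k)) :
    (rotateWord w).Perm (List.finRange k) := by
  obtain ⟨u, v, rfl, hu⟩ :=
    List.eq_append_cons_of_mem (hw.mem_iff.2 (List.mem_finRange (⊤ : Fin k)))
  have h0 : (⊤ : Fin k) + 1 = 0 := by
    obtain ⟨n, rfl⟩ := Nat.exists_eq_succ_of_ne_zero (NeZero.ne k)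
    exact Fin.last_add_one n
  have e : rotateWord (u ++ ⊤ :: v) = (v ++ ⊤ :: u).map (Equiv.addRight (1 : Fin k)) := by
    rw [rotateWord_eq u v hu]
    simp [h0]
  rw [e]
  refine perm_of_map _ (List.Perm.trans ?_ hw)
  exact List.perm_append_comm.trans (by simpa using List.perm_middle.symm)

/-- `M ↦ M^↷`:
`(X_{i_1} ⋯ X_{i_{s-1}} X_k X_{i_{s+1}} ⋯ X_{i_k})^↷
  = X_{i_{s+1}+1} ⋯ X_{i_k+1} X_1 X_{i_1+1} ⋯ X_{i_{s-1}+1}`. -/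
noncomputable def rotateAux (k : ℕ) [NeZero k] :
    FreeAlgebra K (Fin k) →ₗ[K] FreeAlgebra K (Fin k) :=
  onWords K fun w => word K (rotateWord w)

theorem rotateAux_mem (k : ℕ) [NeZero k] :
    ∀ p ∈ multilinear K k, rotateAux K k p ∈ multilinear K k := by
  intro p hp
  refine Submodule.span_induction (p := fun p _ => rotateAux K k p ∈ multilinear K k)
    ?_ (by simp) (fun x y _ _ hx hy => by rw [map_add]; exact add_mem hx hy)
    (fun c x _ hx => by rw [map_smul]; exact Submodule.smul_mem _ c hx) hp
  rintro _ ⟨w, hw, rfl⟩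
  rw [rotateAux, onWords_word]
  exact Submodule.subset_span ⟨_, rotateWord_perm hw, rfl⟩

/-- The rotation `↷` on `𝔐_k`. -/
noncomputable def rotate (k : ℕ) [NeZero k] : multilinear K k →ₗ[K] multilinear K k :=
  (rotateAux K k).restrict (rotateAux_mem K k)

/-! ### Lie monomials and multilinear Lie polynomials -/

/-- The list of variables occurring in a bracket expression, with multiplicity. -/
def leaves {X : Type*} : FreeMagma X → List X
  | .of x => [x]
  | .mul s t => leaves s ++ leaves t

/-- The Lie monomial in the free Lie algebra given by a bracket expression. -/
noncomputable def lieWord {X : Type*} : FreeMagma X → FreeLieAlgebra K X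
  | .of x => FreeLieAlgebra.of K x
  | .mul s t => ⁅lieWord s, lieWord t⁆

/-- The Lie monomials of `X_1, …, X_k` in which each variable occurs exactly once; `-M` counts as a
Lie monomial whenever `M` does. -/
def lieMonomials (k : ℕ) : Set (FreeLieAlgebra K (Fin k)) :=
  {x | ∃ t : FreeMagma (Fin k), (leaves t).Perm (List.finRange k) ∧
    (x = lieWord K t ∨ x = -lieWord K t)}

/-- The space `𝔐_k^Lie` spanned by these Lie monomials, in the free Lie algebra. -/
noncomputable def lieMultilinear (k : ℕ) : Submodule K (FreeLieAlgebra K (Fin k)) :=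
  Submodule.span K (lieMonomials K k)

section Commutators

attribute [local instance] LieRing.ofAssociativeRing

/-- The commutator polynomial of a Lie polynomial: the Lie algebra homomorphism to the
noncommutative polynomials, with the bracket `p q - q p`, that fixes the variables. -/
noncomputable def toCommutators (X : Type*) : FreeLieAlgebra K X →ₗ[K] FreeAlgebra K X :=
  (FreeLieAlgebra.lift K (FreeAlgebra.ι K) : FreeLieAlgebra K X →ₗ⁅K⁆ FreeAlgebra K X)

theorem toCommutators_of {X : Type*} (x : X) :
    toCommutators K X (FreeLieAlgebra.of K x) = FreeAlgebra.ι K x := by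
  simp [toCommutators]

theorem toCommutators_lie {X : Type*} (a b : FreeLieAlgebra K X) :
    toCommutators K X ⁅a, b⁆ =
      toCommutators K X a * toCommutators K X b - toCommutators K X b * toCommutators K X a := by
  simp [toCommutators, LieRing.of_associative_ring_bracket]

end Commutators

theorem toCommutators_lieWord_mem {X : Type*} (t : FreeMagma X) :
    toCommutators K X (lieWord K t) ∈
      Submodule.span K {p | ∃ w : List X, w.Perm (leaves t) ∧ p = word K w} := by
  induction t using FreeMagma.rec with
  | of x =>
    refine Submodule.subset_span ⟨[x], List.Perm.refl _, ?_⟩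
    simp [lieWord, toCommutators_of, word]
  | mul s t hs ht =>
    have key : ∀ (l l' : List X) (p q : FreeAlgebra K X),
        p ∈ Submodule.span K {p | ∃ w : List X, w.Perm l ∧ p = word K w} →
        q ∈ Submodule.span K {p | ∃ w : List X, w.Perm l' ∧ p = word K w} →
        p * q ∈ Submodule.span K {p | ∃ w : List X, w.Perm (l ++ l') ∧ p = word K w} := by
      intro l l' p q hp hq
      have h := Submodule.mul_mem_mul hp hq
      rw [Submodule.span_mul_span] at h
      refine Submodule.span_mono ?_ h
      rintro _ ⟨_, ⟨w, hw, rfl⟩, _, ⟨w', hw', rfl⟩, rfl⟩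
      exact ⟨w ++ w', hw.append hw', by simp [word]⟩
    rw [lieWord, toCommutators_lie]
    refine sub_mem (key _ _ _ _ hs ht) (Submodule.span_mono ?_ (key _ _ _ _ ht hs))
    rintro _ ⟨w, hw, rfl⟩
    exact ⟨w, hw.trans List.perm_append_comm, rfl⟩

theorem toCommutators_mem (k : ℕ) : ∀ x ∈ lieMultilinear K k,
    toCommutators K (Fin k) x ∈ multilinear K k := by
  intro x hx
  refine Submodule.span_induction
    (p := fun x _ => toCommutators K (Fin k) x ∈ multilinear K k)
    ?_ (by simp) (fun x y _ _ hx hy => by rw [map_add]; exact add_mem hx hy)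
    (fun c x _ hx => by rw [map_smul]; exact Submodule.smul_mem _ c hx) hx
  rintro _ ⟨t, ht, h⟩
  have hm : toCommutators K (Fin k) (lieWord K t) ∈ multilinear K k := by
    refine Submodule.span_mono ?_ (toCommutators_lieWord_mem K t)
    rintro _ ⟨w, hw, rfl⟩
    exact ⟨w, hw.trans ht, rfl⟩
  rcases h with rfl | rfl
  · exact hm
  · rw [map_neg]; exact neg_mem hm

/-- The natural map `𝔐_k^Lie → 𝔐_k`, taking brackets to commutators. -/
noncomputable def lieInclusion (k : ℕ) : lieMultilinear K k →ₗ[K] multilinear K k :=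
  (toCommutators K (Fin k)).restrict (toCommutators_mem K k)

end Magnus

/-!
Everything rests on the explicit formula `magnusPoly_eq`: the coefficient of a multilinear word with
`a` ascents and `d` descents in the Magnus commutator is `(-1) ^ d a! d! / (a + d + 1)!`. To obtain
it, the series in question are treated as noncommutative power series: they are homogeneous, so the
central variables only record which letters occur, and coefficients of products are sums over the
ways of cutting a word (`seriesCoef_mul`). The coefficient of `w` in `(F - 1) ^ m`, for `F` the
product of exponentials, thus counts the ways of cutting `w` into `m` nonempty increasing pieces.

*Symmetries.* A multilinear word `w` is encoded by the cyclic word `0 w` on `ℤ / (k + 1)`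
(`zeroCycle`). There the rotation adds `1` to every letter and the reflection negates every
letter, which gives the dihedral relations. Both operations are compatible with cyclic ascents and
descents, hence with the coefficients (`magnusCoeff_rotateWord`, `magnusCoeff_map_rev`).

*Lie monomials.* A bracket expression in `X_1, …, X_k` is a planar binary tree with root labelled
`0`. By the invariance `⟨a, [s, t]⟩ = ⟨[a, s], t⟩` of the trace form, the rotation moves the root to
the leaf `k` and relabels, so it takes Lie monomials to Lie monomials (`exists_reroot`). The Dynkin
map `x_1 ⋯ x_s a ↦ [x_1, [… , [x_s, a]]]` inverts the natural map from multilinear Lie polynomials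
to noncommutative polynomials (`dynkin_lieWord`); so that map is injective, and a multilinear
polynomial which is a Lie polynomial comes from a multilinear one (`toCommutators_dynkin`).

*The Magnus commutator is a Lie polynomial* (`magnusSum_mem`). Exchanging two neighbouring variables
changes it by a Magnus commutator in one variable less, with the commutator of the two inserted
(`magnusSum_sub_swap`); by induction this is a Lie polynomial. Hence the Magnus commutator is
symmetric modulo Lie polynomials. For `k ≥ 2` its symmetrization is the sum of all its coefficients
times the sum of all multilinear monomials, and the sum of the coefficients vanishes: already the
words which arise from a given one by inserting a smallest letter contribute `0`
(`sum_insertions_magnusCoeff`).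
-/

namespace Magnus

/-! ### Coefficients of noncommutative polynomials -/

section Coefficients

variable (K : Type*) [Field K] {X : Type*}

theorem word_nil : word K ([] : List X) = 1 := by simp [word]

theorem word_cons (a : X) (w : List X) : word K (a :: w) = FreeAlgebra.ι K a * word K w := by
  simp [word]

theorem word_append (u v : List X) : word K (u ++ v) = word K u * word K v := by simp [word]

theorem lift_word {A : Type*} [Ring A] [Algebra K A] (x : X → A) (w : List X) :
    FreeAlgebra.lift K x (word K w) = (w.map x).prod := by
  simp [word, map_list_prod, Function.comp_def]

theorem linearMap_ext_word {V : Type*} [AddCommGroup V] [Module K V]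
    {f g : FreeAlgebra K X →ₗ[K] V} (h : ∀ w, f (word K w) = g (word K w)) : f = g := by
  refine (FreeAlgebra.basisFreeMonoid K X).ext fun w => ?_
  have := basis_eq_word K w.toList
  rw [FreeMonoid.ofList_toList] at this
  rw [this]
  exact h _

/-- The coefficient of the monomial `w` in a noncommutative polynomial. -/
noncomputable def coef (w : List X) : FreeAlgebra K X →ₗ[K] K :=
  onWords K fun v => Finsupp.single v 1 w

theorem coef_word_self (w : List X) : coef K w (word K w) = 1 := by
  simp [coef, onWords_word]

theorem coef_word_ne {v w : List X} (h : v ≠ w) : coef K w (word K v) = 0 := by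
  rw [coef, onWords_word, Finsupp.single_eq_of_ne h.symm]

theorem ext_coef {p q : FreeAlgebra K X} (h : ∀ w, coef K w p = coef K w q) : p = q := by
  refine (FreeAlgebra.basisFreeMonoid K X).ext_elem fun w => ?_
  have key : ∀ w : FreeMonoid X,
      coef K w.toList = (FreeAlgebra.basisFreeMonoid K X).coord w := by
    intro w
    refine linearMap_ext_word K fun v => ?_
    rw [coef, onWords_word, ← basis_eq_word, Module.Basis.coord_apply, Module.Basis.repr_self]
    classical
    simp only [Finsupp.single_apply]
    congr
  have := h w.toList
  rwa [key, Module.Basis.coord_apply, Module.Basis.coord_apply] at this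

theorem coef_mul (w : List X) (p q : FreeAlgebra K X) :
    coef K w (p * q) =
      ∑ i ∈ Finset.range (w.length + 1), coef K (w.take i) p * coef K (w.drop i) q := by
  have h : (LinearMap.mul K (FreeAlgebra K X)).compr₂ (coef K w) =
      ∑ i ∈ Finset.range (w.length + 1),
        (LinearMap.mul K K).compl₁₂ (coef K (w.take i)) (coef K (w.drop i)) := by
    refine linearMap_ext_word K fun u => linearMap_ext_word K fun v => ?_
    simp only [LinearMap.compr₂_apply, LinearMap.mul_apply', LinearMap.sum_apply,
      LinearMap.compl₁₂_apply, ← word_append]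
    by_cases huv : u ++ v = w
    · subst huv
      rw [coef_word_self, Finset.sum_eq_single u.length]
      · simp [coef_word_self]
      · intro i hi hne
        rw [coef_word_ne, zero_mul]
        intro he
        have := congrArg List.length he
        rw [List.length_take] at this
        simp only [Finset.mem_range] at hi
        omega
      · intro h; exact absurd (Finset.mem_range.2 (by simp)) h
    · rw [coef_word_ne K huv, Finset.sum_eq_zero]
      intro i _
      by_cases hu : u = w.take i
      · by_cases hv : v = w.drop i
        · exact absurd (by rw [hu, hv, List.take_append_drop]) huv
        · rw [coef_word_ne K hv, mul_zero]
      · rw [coef_word_ne K hu, zero_mul]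
  have := LinearMap.congr_fun (LinearMap.congr_fun h p) q
  simpa only [LinearMap.compr₂_apply, LinearMap.mul_apply', LinearMap.sum_apply,
      LinearMap.compl₁₂_apply] using this

end Coefficients

/-! ### Homogeneous power series -/

section Homogeneous

variable (K : Type*) [Field K] {X : Type*}

/-- The multidegree of the monomial `w`. -/
noncomputable def wordDegree (w : List X) : X →₀ ℕ :=
  (w.map fun i => Finsupp.single i 1).sum

theorem wordDegree_append (u v : List X) :
    wordDegree (u ++ v) = wordDegree u + wordDegree v := by simp [wordDegree]

theorem wordDegree_cons (a : X) (w : List X) :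
    wordDegree (a :: w) = Finsupp.single a 1 + wordDegree w := by simp [wordDegree]

theorem wordDegree_apply [DecidableEq X] (w : List X) (i : X) : wordDegree w i = w.count i := by
  induction w with
  | nil => simp [wordDegree]
  | cons a w ih =>
    rw [wordDegree_cons, Finsupp.add_apply, ih, List.count_cons, add_comm, Finsupp.single_apply]
    simp

theorem degree_wordDegree (w : List X) : (wordDegree w).degree = w.length := by
  induction w with
  | nil => simp [wordDegree]
  | cons a w ih => rw [wordDegree_cons, map_add, ih]; simp [add_comm]

/-- A series is homogeneous when its coefficient of multidegree `d` only involves monomials of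
multidegree `d`; then `t_i` merely records the occurrences of `X_i`. -/
def IsHomog (G : MvPowerSeries X (FreeAlgebra K X)) : Prop :=
  ∀ d w, d ≠ wordDegree w → coef K w (MvPowerSeries.coeff d G) = 0

/-- The coefficient of the monomial `w`, together with its multidegree, in a series. -/
noncomputable def seriesCoef (w : List X) (G : MvPowerSeries X (FreeAlgebra K X)) : K :=
  coef K w (MvPowerSeries.coeff (wordDegree w) G)

variable {K}

theorem IsHomog.mul {G H : MvPowerSeries X (FreeAlgebra K X)} (hG : IsHomog K G)
    (hH : IsHomog K H) : IsHomog K (G * H) := by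
  classical
  intro d w hd
  rw [MvPowerSeries.coeff_mul, map_sum, Finset.sum_eq_zero]
  rintro ⟨d₁, d₂⟩ hdd
  rw [coef_mul, Finset.sum_eq_zero]
  intro i _
  by_cases h₁ : d₁ = wordDegree (w.take i)
  · by_cases h₂ : d₂ = wordDegree (w.drop i)
    · refine absurd ?_ hd
      rw [← Finset.HasAntidiagonal.mem_antidiagonal.1 hdd]
      simp only [h₁, h₂, ← wordDegree_append, List.take_append_drop]
    · rw [hH _ _ h₂, mul_zero]
  · rw [hG _ _ h₁, zero_mul]

theorem IsHomog.sub {G H : MvPowerSeries X (FreeAlgebra K X)} (hG : IsHomog K G)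
    (hH : IsHomog K H) : IsHomog K (G - H) := by
  intro d w hd
  rw [map_sub, map_sub, hG d w hd, hH d w hd, sub_zero]

theorem coef_one_of_ne {w : List X} (hw : w ≠ []) : coef K w (1 : FreeAlgebra K X) = 0 := by
  rw [← word_nil]; exact coef_word_ne K hw.symm

theorem coef_nil_one : coef K ([] : List X) (1 : FreeAlgebra K X) = 1 := by
  rw [← word_nil]; exact coef_word_self K _

theorem isHomog_one : IsHomog K (1 : MvPowerSeries X (FreeAlgebra K X)) := by
  classical
  intro d w hd
  rw [MvPowerSeries.coeff_one]
  split_ifs with h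
  · refine coef_one_of_ne ?_
    rintro rfl
    exact hd (by simp [wordDegree, h])
  · exact map_zero _

theorem IsHomog.pow {G : MvPowerSeries X (FreeAlgebra K X)} (hG : IsHomog K G) (m : ℕ) :
    IsHomog K (G ^ m) := by
  induction m with
  | zero => rw [pow_zero]; exact isHomog_one
  | succ m ih => rw [pow_succ]; exact ih.mul hG

theorem IsHomog.list_prod (l : List (MvPowerSeries X (FreeAlgebra K X)))
    (h : ∀ G ∈ l, IsHomog K G) : IsHomog K l.prod := by
  induction l with
  | nil => exact isHomog_one
  | cons G l ih =>
    rw [List.prod_cons]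
    exact (h G (by simp)).mul (ih fun H hH => h H (by simp [hH]))

theorem seriesCoef_sub (w : List X) (G H : MvPowerSeries X (FreeAlgebra K X)) :
    seriesCoef K w (G - H) = seriesCoef K w G - seriesCoef K w H := by
  simp [seriesCoef]

theorem seriesCoef_one_of_ne {w : List X} (hw : w ≠ []) :
    seriesCoef K w (1 : MvPowerSeries X (FreeAlgebra K X)) = 0 := by
  classical
  rw [seriesCoef, MvPowerSeries.coeff_one]
  split_ifs
  · exact coef_one_of_ne hw
  · exact map_zero _

theorem seriesCoef_nil_one :
    seriesCoef K [] (1 : MvPowerSeries X (FreeAlgebra K X)) = 1 := by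
  classical
  rw [seriesCoef, MvPowerSeries.coeff_one, if_pos (by simp [wordDegree]), coef_nil_one]

/-- Coefficients of products of homogeneous series are convolutions over the ways of cutting the
word in two. -/
theorem seriesCoef_mul {G H : MvPowerSeries X (FreeAlgebra K X)} (hG : IsHomog K G)
    (hH : IsHomog K H) (w : List X) :
    seriesCoef K w (G * H) = ∑ i ∈ Finset.range (w.length + 1),
      seriesCoef K (w.take i) G * seriesCoef K (w.drop i) H := by
  classical
  rw [seriesCoef, MvPowerSeries.coeff_mul, map_sum]
  simp only [coef_mul]
  rw [Finset.sum_comm]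
  refine Finset.sum_congr rfl fun i _ => ?_
  rw [Finset.sum_eq_single (wordDegree (w.take i), wordDegree (w.drop i))]
  · rfl
  · rintro ⟨d₁, d₂⟩ hdd hne
    by_cases h₁ : d₁ = wordDegree (w.take i)
    · by_cases h₂ : d₂ = wordDegree (w.drop i)
      · exact absurd (by rw [h₁, h₂]) hne
      · rw [hH _ _ h₂, mul_zero]
    · rw [hG _ _ h₁, zero_mul]
  · intro h
    refine absurd ?_ h
    rw [Finset.HasAntidiagonal.mem_antidiagonal, ← wordDegree_append, List.take_append_drop]

theorem seriesCoef_mul_cons {G H : MvPowerSeries X (FreeAlgebra K X)} (hG : IsHomog K G)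
    (hH : IsHomog K H) (a : X) (w : List X) :
    seriesCoef K (a :: w) (G * H) =
      seriesCoef K [] G * seriesCoef K (a :: w) H + ∑ i ∈ Finset.range (w.length + 1),
        seriesCoef K (a :: w.take i) G * seriesCoef K (w.drop i) H := by
  rw [seriesCoef_mul hG hH, List.length_cons, Finset.sum_range_succ', add_comm]
  rfl

end Homogeneous

/-! ### The coefficients of the exponential product -/

section ExpProduct

variable (K : Type*) [Field K] {X : Type*}

/-- The factor `exp (t_i X_i)`. -/
noncomputable def expVar (i : X) : MvPowerSeries X (FreeAlgebra K X) :=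
  expSeries K (MvPowerSeries.monomial (Finsupp.single i 1) (FreeAlgebra.ι K i))

theorem monomial_single_pow (i : X) (m : ℕ) :
    (MvPowerSeries.monomial (Finsupp.single i 1) (FreeAlgebra.ι K i) :
      MvPowerSeries X (FreeAlgebra K X)) ^ m =
      MvPowerSeries.monomial (wordDegree (List.replicate m i))
        (word K (List.replicate m i)) := by
  induction m with
  | zero => simp [wordDegree, word_nil]
  | succ m ih =>
    rw [pow_succ', ih, MvPowerSeries.monomial_mul_monomial, List.replicate_succ, word_cons,
      wordDegree_cons]

theorem coef_coeff_expVar (i : X) (d : X →₀ ℕ) (w : List X) :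
    coef K w (MvPowerSeries.coeff d (expVar K i)) =
      ∑ m ∈ Finset.range (d.degree + 1), (m.factorial : K)⁻¹ *
        coef K w (MvPowerSeries.coeff d (MvPowerSeries.monomial (wordDegree (List.replicate m i))
          (word K (List.replicate m i)))) := by
  rw [expVar, MvPowerSeries.coeff_apply, expSeries, map_sum]
  refine Finset.sum_congr rfl fun m _ => ?_
  rw [map_smul, smul_eq_mul, monomial_single_pow]

theorem isHomog_expVar (i : X) : IsHomog K (expVar K i) := by
  classical
  intro d w hd
  rw [coef_coeff_expVar, Finset.sum_eq_zero]
  intro m _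
  rw [MvPowerSeries.coeff_monomial]
  split_ifs with h
  · rw [coef_word_ne, mul_zero]
    rintro rfl
    exact hd h
  · rw [map_zero, mul_zero]

theorem seriesCoef_expVar_replicate (i : X) (n : ℕ) :
    seriesCoef K (List.replicate n i) (expVar K i) = (n.factorial : K)⁻¹ := by
  rw [seriesCoef, coef_coeff_expVar, degree_wordDegree, List.length_replicate,
    Finset.sum_eq_single n]
  · rw [MvPowerSeries.coeff_monomial_same, coef_word_self, mul_one]
  · intro m _ hm
    rw [MvPowerSeries.coeff_monomial_ne, map_zero, mul_zero]
    intro h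
    have := congrArg Finsupp.degree h
    simp only [degree_wordDegree, List.length_replicate] at this
    exact hm this.symm
  · simp

theorem seriesCoef_expVar_of_ne {i : X} {w : List X} (h : ∀ n, w ≠ List.replicate n i) :
    seriesCoef K w (expVar K i) = 0 := by
  classical
  rw [seriesCoef, coef_coeff_expVar, Finset.sum_eq_zero]
  intro m _
  rw [MvPowerSeries.coeff_monomial]
  split_ifs
  · rw [coef_word_ne K (h m).symm, mul_zero]
  · rw [map_zero, mul_zero]

theorem seriesCoef_nil_expVar (i : X) : seriesCoef K [] (expVar K i) = 1 := by
  simpa using seriesCoef_expVar_replicate K i 0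

theorem seriesCoef_nil_mul {G H : MvPowerSeries X (FreeAlgebra K X)} (hG : IsHomog K G)
    (hH : IsHomog K H) :
    seriesCoef K [] (G * H) = seriesCoef K [] G * seriesCoef K [] H := by
  rw [seriesCoef_mul hG hH]; simp

theorem seriesCoef_cons_expVar_mul [DecidableEq X] {G : MvPowerSeries X (FreeAlgebra K X)}
    (hG : IsHomog K G) (i a : X) {w : List X} (hw : (a :: w).Nodup) :
    seriesCoef K (a :: w) (expVar K i * G) =
      seriesCoef K (a :: w) G + if a = i then seriesCoef K w G else 0 := by
  rw [seriesCoef_mul_cons (isHomog_expVar K i) hG, seriesCoef_nil_expVar, one_mul,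
    Finset.sum_range_succ', Finset.sum_eq_zero, zero_add]
  · congr 1
    rw [List.take_zero, List.drop_zero]
    split_ifs with h
    · subst h
      have := seriesCoef_expVar_replicate K a 1
      rw [List.replicate_one] at this
      rw [this]; simp
    · rw [seriesCoef_expVar_of_ne, zero_mul]
      intro n hn
      rcases n with _ | n
      · simp at hn
      · rw [List.replicate_succ, List.cons_eq_cons] at hn
        exact h hn.1
  · intro j hj
    rcases w with _ | ⟨b, w⟩
    · simp at hj
    · rw [seriesCoef_expVar_of_ne, zero_mul]
      intro n hn
      rw [List.take_succ_cons] at hn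
      rcases n with _ | _ | n
      · simp at hn
      · simp at hn
      · simp only [List.replicate_succ, List.cons_eq_cons] at hn
        rw [hn.1, hn.2.1] at hw
        simp at hw

/-- In a product of exponentials of distinct variables, a squarefree monomial has coefficient `1`
or `0`, according to whether its letters appear in the order of the factors. -/
theorem seriesCoef_prod_expVar [DecidableEq X] (l : List X) (hl : l.Nodup) {w : List X}
    (hw : w.Nodup) :
    seriesCoef K w (l.map (expVar K)).prod = if w.Sublist l then 1 else 0 := by
  have hom : ∀ l : List X, IsHomog K (l.map (expVar K)).prod := fun l =>
    IsHomog.list_prod _ (by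
      intro G hG
      obtain ⟨i, _, rfl⟩ := List.mem_map.1 hG
      exact isHomog_expVar K i)
  induction l generalizing w with
  | nil =>
    rcases w with _ | ⟨a, w⟩
    · simpa using seriesCoef_nil_one
    · simpa using seriesCoef_one_of_ne (by simp)
  | cons i l ih =>
    have hi := List.nodup_cons.1 hl
    rw [List.map_cons, List.prod_cons]
    rcases w with _ | ⟨a, w⟩
    · rw [seriesCoef_nil_mul K (isHomog_expVar K i) (hom l), seriesCoef_nil_expVar,
        ih hi.2 List.nodup_nil]
      simp
    · rw [seriesCoef_cons_expVar_mul K (hom l) i a hw, ih hi.2 hw,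
        ih hi.2 (List.nodup_cons.1 hw).2]
      by_cases hai : a = i
      · subst hai
        have h1 : ¬ (a :: w).Sublist l := fun h => hi.1 (h.subset (by simp))
        simp [h1, List.cons_sublist_cons]
      · have h2 : (a :: w).Sublist (i :: l) ↔ (a :: w).Sublist l := by
          constructor
          · intro h
            cases h with
            | cons _ h => exact h
            | cons_cons _ h => exact absurd rfl hai
          · exact fun h => h.cons i
        simp [hai, h2]

end ExpProduct

/-! ### Ascents, descents and the coefficients of the logarithm -/

section Statistics

variable {X : Type*} [LinearOrder X]

/-- The number of ascents `w_i < w_{i+1}` of a word. -/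
def ascents : List X → ℕ
  | a :: b :: w => (if a < b then 1 else 0) + ascents (b :: w)
  | _ => 0

/-- The number of descents of a word, i.e. of places which are not ascents. -/
def descents : List X → ℕ
  | a :: b :: w => (if a < b then 0 else 1) + descents (b :: w)
  | _ => 0

theorem ascents_add_descents (a : X) (w : List X) :
    ascents (a :: w) + descents (a :: w) = w.length := by
  induction w generalizing a with
  | nil => rfl
  | cons b w ih =>
    have := ih b
    simp only [ascents, descents, List.length_cons]
    split_ifs <;> omega

/-- The number `(-1) ^ d * a! * d! / (a + d + 1)! = ∫₀¹ x ^ a * (x - 1) ^ d dx`. -/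
def magnusNumber (K : Type*) [Field K] (a d : ℕ) : K :=
  (-1) ^ d * (a.factorial * d.factorial) / (a + d + 1).factorial

/-- The coefficient `(-1) ^ d a! d! / (a + d + 1)!` of a word with `a` ascents and `d` descents in
the Magnus commutator. -/
def magnusCoeff (K : Type*) [Field K] (w : List X) : K :=
  magnusNumber K (ascents w) (descents w)

theorem magnusNumber_succ_sub (K : Type*) [Field K] [CharZero K] (a d : ℕ) :
    magnusNumber K (a + 1) d - magnusNumber K a (d + 1) = magnusNumber K a d := by
  have h : ((a + d + 1).factorial : K) ≠ 0 := Nat.cast_ne_zero.2 (Nat.factorial_ne_zero _)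
  have h' : (a + d + 1 + 1 : K) ≠ 0 := by exact_mod_cast Nat.succ_ne_zero (a + d + 1)
  simp only [magnusNumber]
  rw [show a + 1 + d + 1 = (a + d + 1) + 1 by ring, show a + (d + 1) + 1 = (a + d + 1) + 1 by ring]
  simp only [Nat.factorial_succ a, Nat.factorial_succ d, Nat.factorial_succ (a + d + 1)]
  push_cast
  field_simp
  ring

/-- The sum over all places where a letter smaller than all others can be inserted. -/
theorem magnusNumber_insertion (K : Type*) [Field K] (a d : ℕ) :
    (d + 1) * magnusNumber K (a + 1) d + (a + 1) * magnusNumber K a (d + 1) = 0 := by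
  simp only [magnusNumber]
  rw [show a + 1 + d + 1 = (a + d + 1) + 1 by ring, show a + (d + 1) + 1 = (a + d + 1) + 1 by ring]
  simp only [Nat.factorial_succ a, Nat.factorial_succ d]
  push_cast
  ring

end Statistics

section Logarithm

variable {K : Type*} [Field K] {X : Type*} [LinearOrder X]

/-- A letter `a` in front of `b` either forms a factor of its own, or, if `a < b`, it extends
the factor which starts with `b`. -/
theorem seriesCoef_pow_succ_cons_cons {G : MvPowerSeries X (FreeAlgebra K X)} (hG : IsHomog K G)
    (h₀ : seriesCoef K [] G = 0)
    (h₁ : ∀ u : List X, u ≠ [] → u.Nodup →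
      seriesCoef K u G = if u.Pairwise (· < ·) then 1 else 0)
    (m : ℕ) (a b : X) {w : List X} (hw : (a :: b :: w).Nodup) :
    seriesCoef K (a :: b :: w) (G ^ (m + 1)) =
      seriesCoef K (b :: w) (G ^ m) +
        if a < b then seriesCoef K (b :: w) (G ^ (m + 1)) else 0 := by
  have hnd : ∀ i, (a :: b :: w.take i).Nodup := fun i =>
    hw.sublist (((List.take_sublist i w).cons_cons b).cons_cons a)
  have hstep : ∀ i, seriesCoef K (a :: b :: w.take i) G =
      if a < b then seriesCoef K (b :: w.take i) G else 0 := by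
    intro i
    rw [h₁ _ (by simp) (hnd i), h₁ _ (by simp) (List.nodup_cons.1 (hnd i)).2]
    by_cases hab : a < b
    · have : (a :: b :: w.take i).Pairwise (· < ·) ↔ (b :: w.take i).Pairwise (· < ·) := by
        rw [List.pairwise_cons]
        refine ⟨fun h => h.2, fun h => ⟨fun c hc => ?_, h⟩⟩
        rcases List.mem_cons.1 hc with rfl | hc
        · exact hab
        · exact hab.trans ((List.pairwise_cons.1 h).1 c hc)
      simp [hab, this]
    · have : ¬ (a :: b :: w.take i).Pairwise (· < ·) := fun h =>
        hab ((List.pairwise_cons.1 h).1 b (by simp))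
      simp [hab, this]
  have ha : seriesCoef K [a] G = 1 := by rw [h₁ _ (by simp) (by simp)]; simp
  rw [pow_succ', seriesCoef_mul_cons hG (hG.pow m), h₀, zero_mul, zero_add,
    seriesCoef_mul_cons hG (hG.pow m), h₀, zero_mul, zero_add, List.length_cons,
    Finset.sum_range_succ', add_comm]
  simp only [List.take_zero, List.drop_zero, ha, one_mul, List.take_succ_cons,
    List.drop_succ_cons, hstep]
  split_ifs <;> simp

/-- The coefficient of a word in the logarithm of the exponential product. The shift `j` makes the
induction on the word go through: a descent turns `j` into `j + 1`. -/
theorem sum_seriesCoef_pow [CharZero K] {G : MvPowerSeries X (FreeAlgebra K X)}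
    (hG : IsHomog K G) (h₀ : seriesCoef K [] G = 0)
    (h₁ : ∀ u : List X, u ≠ [] → u.Nodup →
      seriesCoef K u G = if u.Pairwise (· < ·) then 1 else 0)
    (w : List X) (a : X) (hw : (a :: w).Nodup) (n : ℕ) (hn : w.length < n) (j : ℕ) :
    ∑ m ∈ Finset.range n, (-1 : K) ^ (m + j) * ((m + j + 1 : ℕ) : K)⁻¹ *
        seriesCoef K (a :: w) (G ^ (m + 1)) =
      (-1) ^ (descents (a :: w) + j) *
        ((ascents (a :: w)).factorial * (descents (a :: w) + j).factorial) /
          (ascents (a :: w) + (descents (a :: w) + j) + 1).factorial := by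
  change _ = magnusNumber K (ascents (a :: w)) (descents (a :: w) + j)
  induction w generalizing a n j with
  | nil =>
    obtain ⟨n, rfl⟩ := Nat.exists_eq_succ_of_ne_zero (Nat.ne_of_gt hn)
    have key : ∀ m, seriesCoef K [a] (G ^ (m + 1)) = if m = 0 then 1 else 0 := by
      intro m
      have ha : seriesCoef K [a] G = 1 := by rw [h₁ _ (by simp) (by simp)]; simp
      rw [pow_succ', seriesCoef_mul_cons hG (hG.pow m), h₀]
      rcases m with _ | m
      · simp [seriesCoef_nil_one, ha]
      · have : seriesCoef K [] (G ^ (m + 1)) = 0 := by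
          rw [pow_succ', seriesCoef_nil_mul K hG (hG.pow m), h₀, zero_mul]
        simp [this]
    rw [Finset.sum_range_succ', Finset.sum_eq_zero, zero_add, key]
    · have h : (j.factorial : K) ≠ 0 := Nat.cast_ne_zero.2 (Nat.factorial_ne_zero _)
      have h' : (j + 1 : K) ≠ 0 := by exact_mod_cast Nat.succ_ne_zero j
      simp only [ascents, descents, magnusNumber, zero_add, Nat.factorial, if_true]
      push_cast
      field_simp
    · intro m _; rw [key]; simp
  | cons b w ih =>
    obtain ⟨n, rfl⟩ := Nat.exists_eq_succ_of_ne_zero (Nat.ne_of_gt (Nat.zero_lt_of_lt hn))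
    have hb := (List.nodup_cons.1 hw).2
    have hn' : w.length < n := by simpa using hn
    simp only [seriesCoef_pow_succ_cons_cons hG h₀ h₁ _ a b hw, mul_add, Finset.sum_add_distrib]
    have first : ∑ m ∈ Finset.range (n + 1), (-1 : K) ^ (m + j) * ((m + j + 1 : ℕ) : K)⁻¹ *
        seriesCoef K (b :: w) (G ^ m) =
        magnusNumber K (ascents (b :: w)) (descents (b :: w) + (j + 1)) := by
      rw [Finset.sum_range_succ', pow_zero, seriesCoef_one_of_ne (by simp), mul_zero, add_zero,
        ← ih b hb n hn' (j + 1)]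
      refine Finset.sum_congr rfl fun m _ => ?_
      rw [show m + 1 + j = m + (j + 1) by ring]
    rw [Nat.succ_eq_add_one, first]
    split_ifs with hab
    · rw [ih b hb (n + 1) (by omega) j, ascents, descents, if_pos hab, if_pos hab, zero_add,
        add_comm 1, ← add_assoc]
      rw [← magnusNumber_succ_sub K (ascents (b :: w)) (descents (b :: w) + j)]
      ring
    · rw [ascents, descents, if_neg hab, if_neg hab, zero_add]
      simp only [mul_zero, Finset.sum_const_zero, add_zero]
      congr 1
      ring

end Logarithm

/-! ### The explicit formula for the Magnus commutator -/

section Formula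

/-- The words in which each of the `k` letters occurs exactly once. -/
def permWords (k : ℕ) : Finset (List (Fin k)) := (List.finRange k).permutations'.toFinset

theorem mem_permWords {k : ℕ} {w : List (Fin k)} :
    w ∈ permWords k ↔ w.Perm (List.finRange k) := by
  rw [permWords, List.mem_toFinset, List.mem_permutations']

theorem mem_permWords_iff_nodup {k : ℕ} {w : List (Fin k)} :
    w ∈ permWords k ↔ w.Nodup ∧ ∀ i, i ∈ w := by
  rw [mem_permWords]
  constructor
  · exact fun h => ⟨h.nodup_iff.2 (List.nodup_finRange k),
      fun i => h.mem_iff.2 (List.mem_finRange i)⟩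
  · rintro ⟨h, h'⟩
    rw [List.perm_ext_iff_of_nodup h (List.nodup_finRange k)]
    simp [h']

theorem exists_eq_append_cons_of_mem_permWords {k : ℕ} {v : List (Fin k)}
    (hv : v ∈ permWords k) (i : Fin k) : ∃ u z, v = u ++ i :: z ∧ i ∉ u ∧ i ∉ z := by
  obtain ⟨hnd, hmem⟩ := mem_permWords_iff_nodup.1 hv
  obtain ⟨u, z, rfl, hu⟩ := List.eq_append_cons_of_mem (hmem i)
  refine ⟨u, z, rfl, hu, fun hz => ?_⟩
  rw [List.nodup_append] at hnd
  exact (List.nodup_cons.1 hnd.2.1).1 hz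

theorem length_of_mem_permWords {k : ℕ} {w : List (Fin k)} (hw : w ∈ permWords k) :
    w.length = k := by
  simpa using (mem_permWords.1 hw).length_eq

theorem wordDegree_eq_iff {k : ℕ} {w : List (Fin k)} :
    (Finsupp.equivFunOnFinite.symm fun _ : Fin k => 1) = wordDegree w ↔ w ∈ permWords k := by
  rw [mem_permWords, List.perm_iff_count, DFunLike.ext_iff]
  simp only [wordDegree_apply, Finsupp.equivFunOnFinite_symm_apply_apply,
    List.count_eq_one_of_mem (List.nodup_finRange k) (List.mem_finRange _), eq_comm]

variable (K : Type*) [Field K]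

theorem coef_sum_permWords {k : ℕ} (c : List (Fin k) → K) (w : List (Fin k)) :
    coef K w (∑ v ∈ permWords k, c v • word K v) = if w ∈ permWords k then c w else 0 := by
  rw [map_sum]
  split_ifs with h
  · rw [Finset.sum_eq_single w]
    · rw [map_smul, coef_word_self, smul_eq_mul, mul_one]
    · intro v _ hv
      rw [map_smul, coef_word_ne K hv, smul_zero]
    · exact fun h' => absurd h h'
  · refine Finset.sum_eq_zero fun v hv => ?_
    rw [map_smul, coef_word_ne K (by rintro rfl; exact h hv), smul_zero]

variable [CharZero K]

theorem coef_magnusPoly {k : ℕ} [NeZero k] (w : List (Fin k)) :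
    coef K w (magnusPoly K k) = if w ∈ permWords k then magnusCoeff K w else 0 := by
  set F : MvPowerSeries (Fin k) (FreeAlgebra K (Fin k)) :=
    ((List.finRange k).map (expVar K)).prod with hF
  have homF : IsHomog K F := IsHomog.list_prod _ (by
    intro G hG
    obtain ⟨i, _, rfl⟩ := List.mem_map.1 hG
    exact isHomog_expVar K i)
  have homG : IsHomog K (F - 1) := homF.sub isHomog_one
  have cF : ∀ u : List (Fin k), u.Nodup →
      seriesCoef K u F = if u.Pairwise (· < ·) then 1 else 0 := by
    intro u hu
    rw [hF, seriesCoef_prod_expVar K _ (List.nodup_finRange k) hu]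
    congr 1
    refine propext ⟨fun h => (List.pairwise_lt_finRange k).sublist h, fun h => ?_⟩
    exact List.sublist_of_subperm_of_pairwise
      (List.subperm_of_subset hu fun a _ => List.mem_finRange a) h (List.pairwise_lt_finRange k)
  have h₀ : seriesCoef K [] (F - 1) = 0 := by
    rw [seriesCoef_sub, cF [] List.nodup_nil, seriesCoef_nil_one]; simp
  have h₁ : ∀ u : List (Fin k), u ≠ [] → u.Nodup →
      seriesCoef K u (F - 1) = if u.Pairwise (· < ·) then 1 else 0 := by
    intro u hu hn
    rw [seriesCoef_sub, cF u hn, seriesCoef_one_of_ne hu, sub_zero]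
  have hP : magnusPoly K k = ∑ m ∈ Finset.Icc 1 k, ((-1 : K) ^ (m + 1) * (m : K)⁻¹) •
      MvPowerSeries.coeff (Finsupp.equivFunOnFinite.symm fun _ : Fin k => 1) ((F - 1) ^ m) := by
    rw [magnusPoly, List.ofFn_eq_map, MvPowerSeries.coeff_apply, logSeries]
    congr 1
    rw [Finsupp.degree_eq_sum]
    simp
  rw [hP, map_sum]
  simp only [map_smul, smul_eq_mul]
  split_ifs with hw
  · rw [wordDegree_eq_iff.2 hw]
    have hlen := length_of_mem_permWords hw
    rcases w with _ | ⟨a, w⟩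
    · exact absurd hlen.symm (NeZero.ne k)
    · have := sum_seriesCoef_pow homG h₀ h₁ w a (mem_permWords_iff_nodup.1 hw).1 k
        (by simpa using hlen.le) 0
      simp only [add_zero] at this
      rw [magnusCoeff, magnusNumber, ← this]
      refine Finset.sum_bij' (fun m _ => m - 1) (fun m _ => m + 1) ?_ ?_ ?_ ?_ ?_
      · intro m hm; rw [Finset.mem_Icc] at hm; rw [Finset.mem_range]; omega
      · intro m hm; rw [Finset.mem_range] at hm; rw [Finset.mem_Icc]; omega
      · intro m hm; rw [Finset.mem_Icc] at hm; omega
      · intro m hm; omega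
      · intro m hm
        obtain ⟨n, rfl⟩ := Nat.exists_eq_add_of_le' (Finset.mem_Icc.1 hm).1
        rw [Nat.add_sub_cancel, pow_succ, pow_succ, mul_neg_one, mul_neg_one, neg_neg]
        rfl
  · refine Finset.sum_eq_zero fun m _ => ?_
    rw [homG.pow m _ _ fun h => hw (wordDegree_eq_iff.1 h), mul_zero]

/-- The classical formula for the Magnus commutator in terms of ascents and descents. -/
theorem magnusPoly_eq (k : ℕ) [NeZero k] :
    magnusPoly K k = ∑ w ∈ permWords k, magnusCoeff K w • word K w :=
  ext_coef K fun w => by rw [coef_magnusPoly, coef_sum_permWords]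

theorem magnus_eq {k : ℕ} [NeZero k] {A : Type*} [Ring A] [Algebra K A] (x : Fin k → A) :
    magnus K x = ∑ w ∈ permWords k, magnusCoeff K w • (w.map x).prod := by
  rw [magnus, magnusPoly_eq, map_sum]
  simp only [map_smul, lift_word]

end Formula

/-! ### Ascents and descents of concatenated and relabelled words -/

section Statistics

variable {X : Type*} [LinearOrder X]

theorem ascents_append_cons (u : List X) (a : X) (v : List X) :
    ascents (u ++ a :: v) = ascents (u ++ [a]) + ascents (a :: v) := by
  induction u with
  | nil => simp [ascents]
  | cons b u ih =>
    rcases u with _ | ⟨c, u⟩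
    · simp [ascents]
    · simp only [List.cons_append, ascents] at ih ⊢
      rw [ih, add_assoc]

theorem descents_append_cons (u : List X) (a : X) (v : List X) :
    descents (u ++ a :: v) = descents (u ++ [a]) + descents (a :: v) := by
  induction u with
  | nil => simp [descents]
  | cons b u ih =>
    rcases u with _ | ⟨c, u⟩
    · simp [descents]
    · simp only [List.cons_append, descents] at ih ⊢
      rw [ih, add_assoc]

theorem ascents_concat_of_lt {l : List X} {a : X} (h : ∀ x ∈ l, x < a) :
    ascents (l ++ [a]) = ascents l + (if l = [] then 0 else 1) ∧
      descents (l ++ [a]) = descents l := by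
  induction l with
  | nil => simp [ascents, descents]
  | cons b l ih =>
    have ih := ih fun x hx => h x (by simp [hx])
    rcases l with _ | ⟨c, l⟩
    · simp [ascents, descents, h b (by simp)]
    · simp only [List.cons_append, ascents, descents, reduceCtorEq, if_false] at ih ⊢
      omega

theorem ascents_concat_of_gt {l : List X} {a : X} (h : ∀ x ∈ l, a < x) :
    ascents (l ++ [a]) = ascents l ∧
      descents (l ++ [a]) = descents l + (if l = [] then 0 else 1) := by
  induction l with
  | nil => simp [ascents, descents]
  | cons b l ih =>
    have ih := ih fun x hx => h x (by simp [hx])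
    rcases l with _ | ⟨c, l⟩
    · simp [ascents, descents, (h b (by simp)).le]
    · simp only [List.cons_append, ascents, descents, reduceCtorEq, if_false] at ih ⊢
      omega

theorem ascents_cons_of_lt {l : List X} {a : X} (h : ∀ x ∈ l, a < x) :
    ascents (a :: l) = ascents l + (if l = [] then 0 else 1) ∧
      descents (a :: l) = descents l := by
  rcases l with _ | ⟨c, l⟩
  · simp [ascents, descents]
  · simp [ascents, descents, h c (by simp), add_comm]

theorem ascents_cons_of_gt {l : List X} {a : X} (h : ∀ x ∈ l, x < a) :
    ascents (a :: l) = ascents l ∧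
      descents (a :: l) = descents l + (if l = [] then 0 else 1) := by
  rcases l with _ | ⟨c, l⟩
  · simp [ascents, descents]
  · simp [ascents, descents, (h c (by simp)).le, add_comm]

/-- A relabelling which preserves the order of neighbouring letters preserves ascents and
descents. -/
theorem ascents_map {Y : Type*} [LinearOrder Y] (f : X → Y) {l : List X}
    (h : l.IsChain fun x y => f x < f y ↔ x < y) :
    ascents (l.map f) = ascents l ∧ descents (l.map f) = descents l := by
  induction l with
  | nil => exact ⟨rfl, rfl⟩
  | cons b l ih =>
    rcases l with _ | ⟨c, l⟩
    · exact ⟨rfl, rfl⟩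
    · rw [List.isChain_cons_cons] at h
      have ih := ih h.2
      simp only [List.map_cons, ascents, descents, h.1] at ih ⊢
      omega

theorem magnusCoeff_map (K : Type*) [Field K] {Y : Type*} [LinearOrder Y] (f : X → Y) {l : List X}
    (h : l.IsChain fun x y => f x < f y ↔ x < y) :
    magnusCoeff K (l.map f) = magnusCoeff K l := by
  rw [magnusCoeff, (ascents_map f h).1, (ascents_map f h).2, magnusCoeff]

theorem isChain_of_forall_mem {X : Type*} {l : List X} {R : X → X → Prop}
    (h : ∀ x ∈ l, ∀ y ∈ l, R x y) :
    l.IsChain R := by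
  refine List.Pairwise.isChain ?_
  rw [List.pairwise_iff_forall_sublist]
  intro a b hab
  exact h a (hab.subset (by simp)) b (hab.subset (by simp))

theorem ascents_map_antitone {Y : Type*} [LinearOrder Y] {f : X → Y} (hf : StrictAnti f)
    {l : List X} (hl : l.Nodup) :
    ascents (l.map f) = descents l ∧ descents (l.map f) = ascents l := by
  induction l with
  | nil => exact ⟨rfl, rfl⟩
  | cons b l ih =>
    rcases l with _ | ⟨c, l⟩
    · exact ⟨rfl, rfl⟩
    · have ih := ih (List.nodup_cons.1 hl).2
      have hbc : b ≠ c := by rintro rfl; simp at hl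
      simp only [List.map_cons, ascents, descents, hf.lt_iff_gt] at ih ⊢
      rw [ih.1, ih.2]
      rcases lt_or_gt_of_ne hbc with h | h
      · simp [h, h.le]
      · simp [h, h.le]

end Statistics

/-! ### The symmetries of the coefficients -/

section CoefficientSymmetries

variable {k : ℕ} [NeZero k]

theorem add_one_lt_add_one_iff_of_ne_top {x y : Fin k} (hx : x ≠ ⊤) (hy : y ≠ ⊤) :
    x + 1 < y + 1 ↔ x < y := by
  obtain ⟨n, rfl⟩ := Nat.exists_eq_succ_of_ne_zero (NeZero.ne k)
  have hx' : x ≠ Fin.last n := hx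
  have hy' : y ≠ Fin.last n := hy
  rw [Fin.lt_def, Fin.lt_def, Fin.val_add_one, Fin.val_add_one, if_neg hx', if_neg hy']
  omega

theorem add_one_pos_of_ne_top {x : Fin k} (hx : x ≠ ⊤) : 0 < x + 1 := by
  obtain ⟨n, rfl⟩ := Nat.exists_eq_succ_of_ne_zero (NeZero.ne k)
  have hx' : x ≠ Fin.last n := hx
  rw [Fin.lt_def, Fin.val_add_one, if_neg hx']
  simp

theorem rotateWord_mem {w : List (Fin k)} (hw : w ∈ permWords k) :
    rotateWord w ∈ permWords k :=
  mem_permWords.2 (rotateWord_perm (mem_permWords.1 hw))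

/-- Rotating the cyclic word `0 w` and shifting its letters keeps cyclic ascents and descents,
since the cyclically largest letter becomes the smallest one. -/
theorem magnusCoeff_rotateWord (K : Type*) [Field K] {w : List (Fin k)} (hw : w ∈ permWords k) :
    magnusCoeff K (rotateWord w) = magnusCoeff K w := by
  obtain ⟨u, v, rfl, hu, hv⟩ := exists_eq_append_cons_of_mem_permWords hw ⊤
  have ne : ∀ {l : List (Fin k)}, (⊤ : Fin k) ∉ l → ∀ x ∈ l, x ≠ ⊤ := by
    rintro l hl x hx rfl; exact hl hx
  have shift : ∀ l : List (Fin k), (⊤ : Fin k) ∉ l →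
      ascents (l.map (· + 1)) = ascents l ∧ descents (l.map (· + 1)) = descents l := fun l hl =>
    ascents_map _ (isChain_of_forall_mem fun x hx y hy =>
      add_one_lt_add_one_iff_of_ne_top (ne hl x hx) (ne hl y hy))
  have pos : ∀ l : List (Fin k), (⊤ : Fin k) ∉ l → ∀ x ∈ l.map (· + 1), 0 < x := by
    intro l hl x hx
    obtain ⟨y, hy, rfl⟩ := List.mem_map.1 hx
    exact add_one_pos_of_ne_top (ne hl y hy)
  have lt : ∀ l : List (Fin k), (⊤ : Fin k) ∉ l → ∀ x ∈ l, x < ⊤ := fun l hl x hx =>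
    lt_top_iff_ne_top.2 (ne hl x hx)
  rw [rotateWord_eq u v hu, magnusCoeff, magnusCoeff]
  have h1 := ascents_concat_of_gt (pos v hv)
  have h2 := ascents_cons_of_lt (pos u hu)
  have h3 := ascents_concat_of_lt (lt u hu)
  have h4 := ascents_cons_of_gt (lt v hv)
  have e1 := shift u hu
  have e2 := shift v hv
  simp only [List.map_eq_nil_iff] at h1 h2
  rw [ascents_append_cons, descents_append_cons, ascents_append_cons u, descents_append_cons u,
    h1.1, h1.2, h2.1, h2.2, h3.1, h3.2, h4.1, h4.2, e1.1, e1.2, e2.1, e2.2]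
  congr 1 <;> ring

theorem map_rev_mem {k : ℕ} {w : List (Fin k)} (hw : w ∈ permWords k) :
    w.map Fin.rev ∈ permWords k :=
  mem_permWords.2 (perm_of_map Fin.revPerm (mem_permWords.1 hw))

theorem magnusCoeff_map_rev (K : Type*) [Field K] {w : List (Fin k)} (hw : w ∈ permWords k) :
    magnusCoeff K (w.map Fin.rev) = (-1) ^ (k + 1) * magnusCoeff K w := by
  have hlen := length_of_mem_permWords hw
  have h := ascents_map_antitone (f := (Fin.rev : Fin k → Fin k)) Fin.rev_strictAnti
    (mem_permWords_iff_nodup.1 hw).1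
  rcases w with _ | ⟨a, w⟩
  · exact absurd hlen.symm (NeZero.ne k)
  · have had := ascents_add_descents a w
    rw [magnusCoeff, magnusCoeff, h.1, h.2]
    have hk : k = ascents (a :: w) + descents (a :: w) + 1 := by
      rw [had]
      exact hlen.symm
    rw [magnusNumber, magnusNumber,
      show k + 1 = ascents (a :: w) + descents (a :: w) + 1 + 1 by omega]
    generalize ascents (a :: w) = p
    generalize descents (a :: w) = q
    have hq : ((-1 : K) ^ q) * (-1) ^ q = 1 := by rw [← mul_pow]; simp
    rw [add_comm q p, show (-1 : K) ^ (p + q + 1 + 1) = (-1) ^ p * (-1) ^ q by ring,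
      ← mul_div_assoc]
    congr 1
    linear_combination (-(-1 : K) ^ p * (p.factorial * q.factorial)) * hq

end CoefficientSymmetries

/-! ### Cyclic words and the dihedral relations -/

section CyclicWords

variable {k : ℕ}

/-- The cyclic word `0 w` on the alphabet `ℤ / (k + 1)`. On it the rotation acts by adding `1` to
every letter, and the reflection by changing the sign of every letter. -/
def zeroCycle (w : List (Fin k)) : Cycle (Fin (k + 1)) := ((0 :: w.map Fin.succ : List _) : Cycle _)

/-- The letter `0` occurs only once in the cyclic word `0 w`, so it marks where `w` begins. -/
theorem zeroCycle_injective {v w : List (Fin k)} (hv : v.Nodup) (h : zeroCycle v = zeroCycle w) :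
    v = w := by
  have hnd : (0 :: v.map Fin.succ).Nodup := by
    rw [List.nodup_cons]
    refine ⟨fun h => ?_, hv.map (Fin.succ_injective k)⟩
    obtain ⟨x, _, hx⟩ := List.mem_map.1 h
    exact Fin.succ_ne_zero x hx
  obtain ⟨n, hn, h⟩ := List.isRotated_iff_mod.1 (Cycle.coe_eq_coe.1 h)
  have key : (0 :: v.map Fin.succ) = 0 :: w.map Fin.succ := by
    rcases Nat.lt_or_ge n (0 :: v.map Fin.succ).length with hlt | hge
    · have h0 : (0 :: v.map Fin.succ)[n] = 0 := by
        have h' := congrArg (fun l : List (Fin (k + 1)) => l[0]?) h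
        simp only [List.getElem?_cons_zero] at h'
        rw [List.getElem?_rotate (by simp), zero_add, Nat.mod_eq_of_lt hlt,
          List.getElem?_eq_getElem hlt] at h'
        exact Option.some_injective _ h'
      have : n = 0 := (List.Nodup.getElem_inj_iff hnd (hi := hlt) (hj := by simp)).1 h0
      rw [this, List.rotate_zero] at h
      exact h
    · rw [le_antisymm hn hge, List.rotate_length] at h
      exact h
  exact (List.map_injective_iff.2 (Fin.succ_injective k)) (List.cons_eq_cons.1 key).2

theorem zeroCycle_rotateWord [NeZero k] {w : List (Fin k)} (hw : w ∈ permWords k) :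
    zeroCycle (rotateWord w) = (zeroCycle w).map (· + 1) := by
  obtain ⟨n, rfl⟩ := Nat.exists_eq_succ_of_ne_zero (NeZero.ne k)
  obtain ⟨u, v, rfl, hu, hv⟩ := exists_eq_append_cons_of_mem_permWords hw ⊤
  have shift : ∀ l : List (Fin (n + 1)), (⊤ : Fin (n + 1)) ∉ l →
      (l.map (· + 1)).map Fin.succ = (l.map Fin.succ).map (· + 1) := by
    intro l hl
    rw [List.map_map, List.map_map]
    refine List.map_congr_left fun x hx => ?_
    have hx' : x ≠ Fin.last n := by rintro rfl; exact hl hx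
    have hx'' : x.succ ≠ Fin.last (n + 1) := fun h => hx' (Fin.succ_inj.1 h)
    ext
    simp only [Function.comp_apply, Fin.val_succ]
    rw [Fin.val_add_one, Fin.val_add_one, if_neg hx', if_neg hx'', Fin.val_succ]
  have h0 : (Fin.succ (⊤ : Fin (n + 1))) + 1 = 0 := Fin.last_add_one (n + 1)
  have h1 : (Fin.succ (0 : Fin (n + 1))) = 0 + 1 := by simp
  rw [rotateWord_eq u v hu, zeroCycle, zeroCycle, Cycle.map_coe, Cycle.coe_eq_coe]
  simp only [List.map_append, List.map_cons, shift u hu, shift v hv, h0, h1]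
  exact List.isRotated_append (l := 0 :: (v.map Fin.succ).map (· + 1))
    (l' := (0 + 1) :: (u.map Fin.succ).map (· + 1))

theorem zeroCycle_map_rev (w : List (Fin k)) :
    zeroCycle (w.map Fin.rev) = (zeroCycle w).map (fun x => -x) := by
  rw [zeroCycle, zeroCycle, Cycle.map_coe, List.map_cons, List.map_map, List.map_map, neg_zero]
  congr 2
  refine List.map_congr_left fun x _ => ?_
  ext
  simp only [Function.comp_apply, Fin.val_succ, Fin.val_rev, Fin.val_neg]
  have := x.2
  rw [if_neg (Fin.succ_ne_zero x)]
  omega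

theorem cycle_map_map {X Y Z : Type*} (f : X → Y) (g : Y → Z) (c : Cycle X) :
    (c.map f).map g = c.map (g ∘ f) := by
  induction c using Quotient.inductionOn with
  | _ l => exact congrArg _ (List.map_map (f := f) (g := g) (l := l))

theorem cycle_map_id {X : Type*} (c : Cycle X) : c.map id = c := by
  induction c using Quotient.inductionOn with
  | _ l => exact congrArg _ (List.map_id l)

variable [NeZero k]

theorem iterate_rotateWord_mem {w : List (Fin k)} (hw : w ∈ permWords k) (n : ℕ) :
    rotateWord^[n] w ∈ permWords k := by
  induction n with
  | zero => exact hw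
  | succ n ih => rw [Function.iterate_succ_apply']; exact rotateWord_mem ih

theorem iterate_rotateWord {w : List (Fin k)} (hw : w ∈ permWords k) :
    rotateWord^[k + 1] w = w := by
  have h : ∀ n, zeroCycle (rotateWord^[n] w) = (zeroCycle w).map ((· + 1)^[n]) := by
    intro n
    induction n with
    | zero => exact (cycle_map_id _).symm
    | succ n ih =>
      rw [Function.iterate_succ_apply', zeroCycle_rotateWord (iterate_rotateWord_mem hw n), ih,
        cycle_map_map, Function.iterate_succ']
  refine zeroCycle_injective (mem_permWords_iff_nodup.1 (iterate_rotateWord_mem hw _)).1 ?_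
  have hc : (k + 1) • (1 : Fin (k + 1)) = 0 := by
    simpa using card_nsmul_eq_zero (x := (1 : Fin (k + 1)))
  rw [h, add_right_iterate, hc]
  simp only [add_zero]
  exact cycle_map_id (zeroCycle w)

theorem rotateWord_rev_rotateWord_rev {w : List (Fin k)} (hw : w ∈ permWords k) :
    (rotateWord ((rotateWord w).map Fin.rev)).map Fin.rev = w := by
  have hm := rotateWord_mem (map_rev_mem (rotateWord_mem hw))
  refine zeroCycle_injective (mem_permWords_iff_nodup.1 (map_rev_mem hm)).1 ?_
  rw [zeroCycle_map_rev, zeroCycle_rotateWord (map_rev_mem (rotateWord_mem hw)),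
    zeroCycle_map_rev, zeroCycle_rotateWord hw, cycle_map_map, cycle_map_map, cycle_map_map]
  convert cycle_map_id (zeroCycle w) using 2
  funext x
  simp

/-- Sums over all words with every letter once may be reindexed by the rotation. -/
theorem sum_permWords_rotateWord {V : Type*} [AddCommMonoid V] (f : List (Fin k) → V) :
    ∑ w ∈ permWords k, f (rotateWord w) = ∑ w ∈ permWords k, f w := by
  refine Finset.sum_bij' (fun w _ => rotateWord w) (fun w _ => rotateWord^[k] w)
    (fun w hw => rotateWord_mem hw) (fun w hw => iterate_rotateWord_mem hw k)
    (fun w hw => ?_) (fun w hw => ?_) (fun w _ => rfl)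
  · rw [← Function.iterate_succ_apply, iterate_rotateWord hw]
  · rw [← Function.iterate_succ_apply' rotateWord, iterate_rotateWord hw]

theorem sum_permWords_map_rev {k : ℕ} {V : Type*} [AddCommMonoid V] (f : List (Fin k) → V) :
    ∑ w ∈ permWords k, f (w.map Fin.rev) = ∑ w ∈ permWords k, f w :=
  Finset.sum_bij' (fun w _ => w.map Fin.rev) (fun w _ => w.map Fin.rev)
    (fun w hw => map_rev_mem hw) (fun w hw => map_rev_mem hw)
    (fun w _ => by simp [Function.comp_def]) (fun w _ => by simp [Function.comp_def])
    (fun w _ => rfl)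

end CyclicWords

/-! ### Reflection and cyclic symmetry of the Magnus commutator -/

section Symmetries

variable (K : Type*) [Field K] [CharZero K] {k : ℕ} [NeZero k]

theorem magnus_ι (K : Type*) [Field K] (k : ℕ) :
    magnus K (fun i : Fin k => FreeAlgebra.ι K i) = magnusPoly K k := by
  rw [magnus, show (fun i : Fin k => FreeAlgebra.ι K i) = FreeAlgebra.ι K from rfl]
  conv_rhs => rw [← AlgHom.id_apply (R := K) (magnusPoly K k)]
  congr 1
  exact FreeAlgebra.hom_ext (by ext; simp)

theorem daggerAux_magnusPoly : daggerAux K k (magnusPoly K k) = magnusPoly K k := by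
  rw [magnusPoly_eq, map_sum, ← sum_permWords_map_rev fun w => magnusCoeff K w • word K w]
  refine Finset.sum_congr rfl fun w hw => ?_
  rw [map_smul, daggerAux, onWords_word, magnusCoeff_map_rev K hw, smul_smul, mul_comm]

theorem rotateAux_magnusPoly : rotateAux K k (magnusPoly K k) = magnusPoly K k := by
  rw [magnusPoly_eq, map_sum, ← sum_permWords_rotateWord fun w => magnusCoeff K w • word K w]
  refine Finset.sum_congr rfl fun w hw => ?_
  rw [map_smul, rotateAux, onWords_word, magnusCoeff_rotateWord K hw]

theorem magnus_reflection :
    magnus K (fun i : Fin k => FreeAlgebra.ι K i) =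
      -magnus K (fun i : Fin k => -FreeAlgebra.ι K i.rev) := by
  rw [magnus_ι K k, ← daggerAux_magnusPoly, magnus_eq, magnusPoly_eq, map_sum,
    ← Finset.sum_neg_distrib]
  refine Finset.sum_congr rfl fun w hw => ?_
  have h : (w.map fun i : Fin k => -FreeAlgebra.ι K i.rev).prod =
      (-1 : K) ^ w.length • word K (w.map Fin.rev) := by
    clear hw
    induction w with
    | nil => simp [word_nil]
    | cons a w ih =>
      rw [List.map_cons, List.prod_cons, ih, List.map_cons, word_cons, List.length_cons, pow_succ,
        mul_neg_one, neg_smul, neg_mul, mul_smul_comm]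
  rw [h, length_of_mem_permWords hw, map_smul, daggerAux, onWords_word, pow_succ, mul_neg_one,
    neg_smul, smul_neg]

/-- Up to rotation, `0 u k v` is `v 0 u k`, and the latter is the rotated word followed by `k`. -/
theorem zeroCycle_eq_rotateWord_concat {w : List (Fin k)} (hw : w ∈ permWords k) :
    zeroCycle w =
      (((rotateWord w).map Fin.castSucc ++ [Fin.last k] : List (Fin (k + 1))) : Cycle _) := by
  obtain ⟨n, rfl⟩ := Nat.exists_eq_succ_of_ne_zero (NeZero.ne k)
  obtain ⟨u, v, rfl, hu, hv⟩ := exists_eq_append_cons_of_mem_permWords hw ⊤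
  have shift : ∀ l : List (Fin (n + 1)), (⊤ : Fin (n + 1)) ∉ l →
      (l.map (· + 1)).map Fin.castSucc = l.map Fin.succ := by
    intro l hl
    rw [List.map_map]
    refine List.map_congr_left fun x hx => ?_
    have hx' : x ≠ Fin.last n := by rintro rfl; exact hl hx
    ext
    simp only [Function.comp_apply, Fin.val_castSucc, Fin.val_succ]
    rw [Fin.val_add_one, if_neg hx']
  rw [rotateWord_eq u v hu, zeroCycle, Cycle.coe_eq_coe]
  simp only [List.map_append, List.map_cons, shift u hu, shift v hv, Fin.castSucc_zero]
  have := List.isRotated_append (l := 0 :: u.map Fin.succ ++ [Fin.last (n + 1)])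
    (l' := v.map Fin.succ)
  simpa [show Fin.succ (⊤ : Fin (n + 1)) = Fin.last (n + 1) from rfl] using this

theorem magnus_cyclic :
    formalTrace K (Fin (k + 1))
        (FreeAlgebra.ι K 0 * magnus K (fun i : Fin k => FreeAlgebra.ι K i.succ)) =
      formalTrace K (Fin (k + 1))
        (magnus K (fun i : Fin k => FreeAlgebra.ι K i.castSucc) *
          FreeAlgebra.ι K (Fin.last k)) := by
  have e : ∀ (f : Fin k → Fin (k + 1)) (w : List (Fin k)),
      (w.map fun i => FreeAlgebra.ι K (f i)).prod = word K (w.map f) := fun f w => by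
    simp [word, Function.comp_def]
  rw [magnus_eq, magnus_eq, Finset.mul_sum, Finset.sum_mul, map_sum, map_sum]
  rw [← sum_permWords_rotateWord fun w => formalTrace K (Fin (k + 1))
    (magnusCoeff K w • (w.map fun i : Fin k => FreeAlgebra.ι K i.castSucc).prod *
      FreeAlgebra.ι K (Fin.last k))]
  refine Finset.sum_congr rfl fun w hw => ?_
  have hlast : word K [Fin.last k] = FreeAlgebra.ι K (Fin.last k) := by simp [word]
  rw [e, e, mul_smul_comm, smul_mul_assoc, map_smul, map_smul, ← word_cons, ← hlast,
    ← word_append, formalTrace, onWords_word, onWords_word, magnusCoeff_rotateWord K hw,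
    ← zeroCycle_eq_rotateWord_concat hw, zeroCycle]

end Symmetries

/-! ### The dihedral action on multilinear polynomials -/

section Dihedral

/-- The presentation `⟨a, b | a ^ n, b ^ 2, (b a) ^ 2⟩` of the dihedral group. -/
theorem exists_dihedralGroup_hom {M : Type*} [Monoid M] {n : ℕ} [NeZero n] {a b : M}
    (ha : a ^ n = 1) (hb : b * b = 1) (hba : b * a * b * a = 1) :
    ∃ f : DihedralGroup n →* M, f (DihedralGroup.r 1) = a ∧ f (DihedralGroup.sr 0) = b := by
  set e : ZMod n → M := fun i => a ^ i.val with he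
  have e_add : ∀ i j, e (i + j) = e i * e j := fun i j => by
    simp only [he]
    rw [ZMod.val_add, ← pow_add, ← pow_eq_pow_mod _ ha]
  have e_zero : e 0 = 1 := by simp [he]
  have e_neg : ∀ i, e i * e (-i) = 1 := fun i => by rw [← e_add, add_neg_cancel, e_zero]
  have aba : ∀ m : ℕ, a ^ m * b * a ^ m = b := by
    intro m
    induction m with
    | zero => simp
    | succ m ih =>
      have h1 : a * b * a = b := by
        have := congrArg (b * ·) hba
        simpa only [← mul_assoc, hb, one_mul, mul_one] using this
      calc a ^ (m + 1) * b * a ^ (m + 1) = a * (a ^ m * b * a ^ m) * a := by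
            rw [pow_succ' a m]
            simp only [mul_assoc]
            rw [← pow_succ, ← pow_succ']
        _ = b := by rw [ih, h1]
  have swap : ∀ i, e i * b = b * e (-i) := fun i => by
    conv_rhs => rw [← aba i.val]
    rw [mul_assoc (e i * b), show a ^ i.val = e i from rfl, e_neg, mul_one]
  refine ⟨{ toFun := fun g => match g with
                | .r i => e i
                | .sr i => b * e i
            map_one' := e_zero
            map_mul' := ?_ }, ?_, ?_⟩
  · rintro (i | i) (j | j)
    · exact e_add i j
    · change b * e (j - i) = e i * (b * e j)
      rw [← mul_assoc, swap, mul_assoc, ← e_add, neg_add_eq_sub]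
    · change b * e (i + j) = b * e i * e j
      rw [e_add, mul_assoc]
    · change e (j - i) = b * e i * (b * e j)
      rw [mul_assoc, ← mul_assoc (e i), swap, mul_assoc, ← mul_assoc, hb, one_mul, ← e_add,
        neg_add_eq_sub]
  · change a ^ (1 : ZMod n).val = a
    rw [ZMod.val_one_eq_one_mod, ← pow_eq_pow_mod _ ha, pow_one]
  · change b * e 0 = b
    rw [e_zero, mul_one]

variable (K : Type*) [Field K]

theorem word_mem_multilinear {k : ℕ} {w : List (Fin k)} (hw : w ∈ permWords k) :
    word K w ∈ multilinear K k :=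
  Submodule.subset_span ⟨w, mem_permWords.1 hw, rfl⟩

theorem multilinear_hom_ext {k : ℕ} {V : Type*} [AddCommGroup V] [Module K V]
    {f g : multilinear K k →ₗ[K] V}
    (h : ∀ w (hw : w ∈ permWords k), f ⟨word K w, word_mem_multilinear K hw⟩ =
      g ⟨word K w, word_mem_multilinear K hw⟩) : f = g := by
  ext ⟨p, hp⟩
  refine Submodule.span_induction (p := fun p hp => f ⟨p, hp⟩ = g ⟨p, hp⟩) ?_ ?_ ?_ ?_ hp
  · rintro _ ⟨w, hw, rfl⟩
    exact h w (mem_permWords.2 hw)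
  · exact (map_zero f).trans (map_zero g).symm
  · intro x y hx hy h1 h2
    have := congrArg₂ (· + ·) h1 h2
    simp only [← map_add] at this
    exact this
  · intro c x hx h1
    have := congrArg (c • ·) h1
    simp only [← map_smul] at this
    exact this

variable {k : ℕ} [NeZero k]

theorem rotate_word {w : List (Fin k)} (hw : w ∈ permWords k) :
    rotate K k ⟨word K w, word_mem_multilinear K hw⟩ =
      ⟨word K (rotateWord w), word_mem_multilinear K (rotateWord_mem hw)⟩ :=
  Subtype.ext (by rw [rotate, LinearMap.coe_restrict_apply, rotateAux, onWords_word])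

theorem dagger_word {k : ℕ} {w : List (Fin k)} (hw : w ∈ permWords k) :
    dagger K k ⟨word K w, word_mem_multilinear K hw⟩ =
      (-1 : K) ^ (k + 1) • ⟨word K (w.map Fin.rev), word_mem_multilinear K (map_rev_mem hw)⟩ :=
  Subtype.ext (by
    rw [dagger, LinearMap.coe_restrict_apply, daggerAux, onWords_word, Submodule.coe_smul])

theorem rotate_pow_succ : rotate K k ^ (k + 1) = 1 := by
  have h : ∀ (n : ℕ) (w) (hw : w ∈ permWords k),
      (rotate K k ^ n) ⟨word K w, word_mem_multilinear K hw⟩ =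
        ⟨word K (rotateWord^[n] w), word_mem_multilinear K (iterate_rotateWord_mem hw n)⟩ := by
    intro n w hw
    induction n with
    | zero => rfl
    | succ n ih =>
      rw [pow_succ', Module.End.mul_apply, ih, rotate_word K (iterate_rotateWord_mem hw n)]
      simp only [Function.iterate_succ_apply']
  refine multilinear_hom_ext K fun w hw => ?_
  rw [h _ _ hw]
  exact Subtype.ext (congrArg (word K) (iterate_rotateWord hw))

theorem neg_one_pow_mul_self (n : ℕ) : (-1 : K) ^ n * (-1) ^ n = 1 := by
  rw [← mul_pow]; simp

theorem dagger_mul_dagger (k : ℕ) : dagger K k * dagger K k = 1 := by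
  refine multilinear_hom_ext K fun w hw => ?_
  rw [Module.End.mul_apply, dagger_word K hw, map_smul, dagger_word K (map_rev_mem hw), smul_smul,
    neg_one_pow_mul_self, one_smul]
  exact Subtype.ext (by simp [Function.comp_def])

theorem dagger_rotate_relation :
    dagger K k * rotate K k * dagger K k * rotate K k = 1 := by
  refine multilinear_hom_ext K fun w hw => ?_
  simp only [Module.End.mul_apply]
  rw [rotate_word K hw, dagger_word K (rotateWord_mem hw), map_smul,
    rotate_word K (map_rev_mem (rotateWord_mem hw)), map_smul,
    dagger_word K (rotateWord_mem (map_rev_mem (rotateWord_mem hw))), smul_smul,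
    neg_one_pow_mul_self, one_smul]
  exact Subtype.ext (congrArg (word K) (rotateWord_rev_rotateWord_rev hw))

theorem exists_dihedral_representation :
    ∃ ρ : Representation K (DihedralGroup (k + 1)) (multilinear K k),
      ρ (DihedralGroup.r 1) = rotate K k ∧ ρ (DihedralGroup.sr 0) = dagger K k :=
  exists_dihedralGroup_hom (rotate_pow_succ K) (dagger_mul_dagger K k) (dagger_rotate_relation K)

theorem dihedralGroup_induction {n : ℕ} [NeZero n] {P : DihedralGroup n → Prop} (h1 : P 1)
    (hr : P (DihedralGroup.r 1)) (hs : P (DihedralGroup.sr 0))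
    (hmul : ∀ g h, P g → P h → P (g * h)) (g : DihedralGroup n) : P g := by
  have hrot : ∀ i : ZMod n, P (DihedralGroup.r i) := by
    intro i
    have hp : ∀ m : ℕ, P (DihedralGroup.r 1 ^ m) := by
      intro m
      induction m with
      | zero => exact h1
      | succ m ih => rw [pow_succ]; exact hmul _ _ ih hr
    have := hp i.val
    rwa [DihedralGroup.r_pow, one_mul, ZMod.natCast_zmod_val] at this
  rcases g with i | i
  · exact hrot i
  · have := hmul _ _ hs (hrot i)
    rwa [DihedralGroup.sr_mul_r, zero_add] at this

end Dihedral

/-! ### The Dynkin map -/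

section Dynkin

variable (K : Type*) [Field K] {X : Type*}

/-- The action of noncommutative polynomials on the free Lie algebra which extends the adjoint
action. -/
noncomputable def adHom : FreeAlgebra K X →ₐ[K] Module.End K (FreeLieAlgebra K X) :=
  FreeAlgebra.lift K fun x => LieAlgebra.ad K (FreeLieAlgebra K X) (FreeLieAlgebra.of K x)

/-- The span of the monomials with prescribed letters, counted with multiplicity. -/
def permSpan (l : List X) : Submodule K (FreeAlgebra K X) :=
  Submodule.span K {p | ∃ w : List X, w.Perm l ∧ p = word K w}

theorem lieWord_mem_permSpan (t : FreeMagma X) :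
    toCommutators K X (lieWord K t) ∈ permSpan K (leaves t) :=
  toCommutators_lieWord_mem K t

variable {K} in
theorem eq_of_mem_permSpan {V : Type*} [AddCommGroup V] [Module K V] {l : List X}
    {f g : FreeAlgebra K X →ₗ[K] V} (h : ∀ w : List X, w.Perm l → f (word K w) = g (word K w))
    {p : FreeAlgebra K X} (hp : p ∈ permSpan K l) : f p = g p := by
  refine LinearMap.eqOn_span' (f := f) (g := g) ?_ hp
  rintro _ ⟨w, hw, rfl⟩
  exact h w hw

theorem leaves_ne_nil (t : FreeMagma X) : leaves t ≠ [] := by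
  induction t using FreeMagma.rec with
  | of x => simp [leaves]
  | mul s t hs ht => simp [leaves, hs]

theorem adHom_toCommutators (t : FreeMagma X) (z : FreeLieAlgebra K X) :
    adHom K (toCommutators K X (lieWord K t)) z = ⁅lieWord K t, z⁆ := by
  induction t using FreeMagma.rec generalizing z with
  | of x => simp [lieWord, toCommutators_of, adHom]
  | mul s t hs ht =>
    rw [lieWord, toCommutators_lie, map_sub, map_mul, map_mul, LinearMap.sub_apply,
      Module.End.mul_apply, Module.End.mul_apply, hs, ht, hs, ht, lie_lie]

variable [DecidableEq X]

/-- The Dynkin map relative to a letter `a`: it takes a monomial `x_1 ⋯ x_s a` to the bracket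
`[x_1, [… , [x_s, a]]]`, and monomials which do not end with `a` to `0`. -/
noncomputable def dynkin (a : X) : FreeAlgebra K X →ₗ[K] FreeLieAlgebra K X :=
  onWords K fun w => if w.getLast? = some a then
    adHom K (word K w.dropLast) (FreeLieAlgebra.of K a) else 0

theorem dynkin_concat (a : X) (u : List X) :
    dynkin K a (word K (u ++ [a])) = adHom K (word K u) (FreeLieAlgebra.of K a) := by
  simp [dynkin, onWords_word]

theorem dynkin_concat_of_ne {a b : X} (h : b ≠ a) (u : List X) :
    dynkin K a (word K (u ++ [b])) = 0 := by
  simp [dynkin, onWords_word, h]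

theorem dynkin_mul (a : X) (p : FreeAlgebra K X) {l : List X} (hl : l ≠ []) {q : FreeAlgebra K X}
    (hq : q ∈ permSpan K l) : dynkin K a (p * q) = adHom K p (dynkin K a q) := by
  refine eq_of_mem_permSpan (f := dynkin K a ∘ₗ LinearMap.mulLeft K p)
    (g := (adHom K p) ∘ₗ dynkin K a) (fun v hv => ?_) hq
  have h : dynkin K a ∘ₗ LinearMap.mulRight K (word K v) =
      (LinearMap.applyₗ (dynkin K a (word K v))) ∘ₗ (adHom K).toLinearMap := by
    refine linearMap_ext_word K fun u => ?_
    obtain ⟨v', b, rfl⟩ : ∃ v' b, v = v' ++ [b] := by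
      have hne : v ≠ [] := fun h => hl (by rw [h] at hv; exact hv.nil_eq.symm)
      exact ⟨_, _, (List.dropLast_append_getLast hne).symm⟩
    simp only [LinearMap.comp_apply, LinearMap.mulRight_apply, LinearMap.applyₗ_apply_apply,
      AlgHom.toLinearMap_apply]
    rw [← word_append, ← List.append_assoc]
    by_cases hb : b = a
    · subst hb
      rw [dynkin_concat, dynkin_concat, word_append, map_mul, Module.End.mul_apply]
    · rw [dynkin_concat_of_ne K hb, dynkin_concat_of_ne K hb, map_zero]
  exact LinearMap.congr_fun h p

/-- On Lie polynomials, the Dynkin map multiplies by the degree in the letter `a`. -/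
theorem dynkin_lieWord (a : X) (t : FreeMagma X) :
    dynkin K a (toCommutators K X (lieWord K t)) = ((leaves t).count a : K) • lieWord K t := by
  induction t using FreeMagma.rec with
  | of x =>
    rw [lieWord, toCommutators_of, leaves,
      show FreeAlgebra.ι K x = word K ([] ++ [x]) by simp [word]]
    by_cases h : x = a
    · subst h
      rw [dynkin_concat]
      simp [word_nil]
    · rw [dynkin_concat_of_ne K h]
      simp [h]
  | mul s t hs ht =>
    rw [lieWord, toCommutators_lie, map_sub, dynkin_mul K a _ (leaves_ne_nil t)
      (lieWord_mem_permSpan K t), dynkin_mul K a _ (leaves_ne_nil s) (lieWord_mem_permSpan K s),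
      hs, ht, map_smul, map_smul, adHom_toCommutators, adHom_toCommutators, leaves,
      List.count_append, ← lie_skew (lieWord K s) (lieWord K t)]
    push_cast
    module

end Dynkin

/-! ### Multilinear Lie polynomials -/

section LiePolynomials

variable (K : Type*) [Field K] {k : ℕ}

theorem dynkin_toCommutators (a : Fin k) {x : FreeLieAlgebra K (Fin k)}
    (hx : x ∈ lieMultilinear K k) : dynkin K a (toCommutators K (Fin k) x) = x := by
  refine LinearMap.eqOn_span' (f := dynkin K a ∘ₗ toCommutators K (Fin k)) (g := LinearMap.id)
    ?_ hx
  rintro _ ⟨t, ht, h⟩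
  have key : dynkin K a (toCommutators K (Fin k) (lieWord K t)) = lieWord K t := by
    rw [dynkin_lieWord, ht.count_eq,
      List.count_eq_one_of_mem (List.nodup_finRange k) (List.mem_finRange a), Nat.cast_one,
      one_smul]
  rcases h with rfl | rfl
  · exact key
  · simp [key]

theorem coe_lieInclusion (x : lieMultilinear K k) :
    (lieInclusion K k x : FreeAlgebra K (Fin k)) = toCommutators K (Fin k) x := rfl

theorem lieInclusion_injective (k : ℕ) [NeZero k] : Function.Injective (lieInclusion K k) := by
  intro x y h
  have h' := congrArg (fun z : multilinear K k => dynkin K (0 : Fin k) z) h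
  simp only [coe_lieInclusion, dynkin_toCommutators K 0 x.2, dynkin_toCommutators K 0 y.2] at h'
  exact Subtype.ext h'

/-- The bracket expression `[u_1, [u_2, …, [u_s, a]]]`. -/
def rightNormed {X : Type*} (u : List X) (a : X) : FreeMagma X :=
  u.foldr (fun b t => .mul (.of b) t) (.of a)

theorem leaves_rightNormed {X : Type*} (u : List X) (a : X) :
    leaves (rightNormed u a) = u ++ [a] := by
  induction u with
  | nil => rfl
  | cons b u ih =>
    change [b] ++ leaves (rightNormed u a) = _
    rw [ih]; rfl

theorem lieWord_rightNormed {X : Type*} (u : List X) (a : X) :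
    lieWord K (rightNormed u a) = adHom K (word K u) (FreeLieAlgebra.of K a) := by
  induction u with
  | nil => simp [rightNormed, lieWord, word_nil]
  | cons b u ih =>
    change ⁅FreeLieAlgebra.of K b, lieWord K (rightNormed u a)⁆ = _
    rw [ih, word_cons, map_mul, Module.End.mul_apply]
    simp [adHom]

theorem dynkin_mem (a : Fin k) {p : FreeAlgebra K (Fin k)} (hp : p ∈ multilinear K k) :
    dynkin K a p ∈ lieMultilinear K k := by
  refine (Submodule.span_le (p := (lieMultilinear K k).comap (dynkin K a))).2 ?_ hp
  rintro _ ⟨w, hw, rfl⟩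
  change dynkin K a (word K w) ∈ lieMultilinear K k
  have hne : w ≠ [] := List.ne_nil_of_mem (hw.mem_iff.2 (List.mem_finRange a))
  obtain ⟨u, b, rfl⟩ : ∃ u b, w = u ++ [b] := ⟨_, _, (List.dropLast_append_getLast hne).symm⟩
  by_cases hb : b = a
  · subst hb
    rw [dynkin_concat, ← lieWord_rightNormed]
    exact Submodule.subset_span ⟨_, by rwa [leaves_rightNormed], Or.inl rfl⟩
  · rw [dynkin_concat_of_ne K hb]
    exact zero_mem _

/-- The space of Lie polynomials among the noncommutative polynomials. -/
noncomputable def lieSpan (X : Type*) : Submodule K (FreeAlgebra K X) :=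
  Submodule.span K (Set.range fun t : FreeMagma X => toCommutators K X (lieWord K t))

theorem ι_mem_lieSpan {X : Type*} (x : X) : FreeAlgebra.ι K x ∈ lieSpan K X :=
  Submodule.subset_span ⟨.of x, toCommutators_of K x⟩

theorem commutator_mem_lieSpan {X : Type*} {p q : FreeAlgebra K X} (hp : p ∈ lieSpan K X)
    (hq : q ∈ lieSpan K X) : p * q - q * p ∈ lieSpan K X := by
  refine Submodule.span_induction₂ (p := fun p q _ _ => p * q - q * p ∈ lieSpan K X)
    ?_ ?_ ?_ ?_ ?_ ?_ ?_ hp hq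
  · rintro _ _ ⟨s, rfl⟩ ⟨t, rfl⟩
    exact Submodule.subset_span ⟨.mul s t, toCommutators_lie K _ _⟩
  · intro x _; simp
  · intro x _; simp
  · intro x y z _ _ _ h h'
    convert add_mem h h' using 1
    noncomm_ring
  · intro x y z _ _ _ h h'
    convert add_mem h h' using 1
    noncomm_ring
  · intro c x y _ _ h
    convert Submodule.smul_mem _ c h using 1
    rw [smul_mul_assoc, mul_smul_comm, smul_sub]
  · intro c x y _ _ h
    convert Submodule.smul_mem _ c h using 1
    rw [smul_mul_assoc, mul_smul_comm, smul_sub]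

/-- A multilinear polynomial which is a Lie polynomial is one of a multilinear Lie polynomial: by
the Dynkin map, with respect to any letter. -/
theorem toCommutators_dynkin (a : Fin k) {p : FreeAlgebra K (Fin k)}
    (hp : p ∈ multilinear K k) (hp' : p ∈ lieSpan K (Fin k)) :
    toCommutators K (Fin k) (dynkin K a p) = p := by
  -- `θ` multiplies monomials by their degree in `a`, hence multilinear ones by `1`.
  set θ : FreeAlgebra K (Fin k) →ₗ[K] FreeAlgebra K (Fin k) :=
    onWords K fun w => (w.count a : K) • word K w with hθ
  have hθl : ∀ {l : List (Fin k)} {q}, q ∈ permSpan K l → θ q = (l.count a : K) • q := by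
    intro l q hq
    refine eq_of_mem_permSpan (f := θ) (g := (l.count a : K) • LinearMap.id) (fun w hw => ?_) hq
    rw [hθ, onWords_word, hw.count_eq]
    rfl
  have h1 : toCommutators K (Fin k) (dynkin K a p) = θ p := by
    refine LinearMap.eqOn_span' (f := toCommutators K (Fin k) ∘ₗ dynkin K a) (g := θ) ?_ hp'
    rintro _ ⟨t, rfl⟩
    rw [hθl (lieWord_mem_permSpan K t), LinearMap.comp_apply, dynkin_lieWord, map_smul]
  rw [h1, hθl (l := List.finRange k) hp,
    List.count_eq_one_of_mem (List.nodup_finRange k) (List.mem_finRange a), Nat.cast_one, one_smul]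

end LiePolynomials

/-! ### The dihedral action on Lie monomials -/

section LieMonomials

variable (K : Type*) [Field K]

theorem leaves_map {X Y : Type*} (f : X → Y) (t : FreeMagma X) :
    leaves (FreeMagma.map f t) = (leaves t).map f := by
  induction t using FreeMagma.rec with
  | of x => rfl
  | mul s t hs ht =>
    change leaves (FreeMagma.map f s) ++ leaves (FreeMagma.map f t) = _
    rw [hs, ht, leaves, List.map_append]

/-- The substitution of variables in noncommutative polynomials. -/
noncomputable def relabel {X Y : Type*} (f : X → Y) : FreeAlgebra K X →ₐ[K] FreeAlgebra K Y :=
  FreeAlgebra.lift K fun x => FreeAlgebra.ι K (f x)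

theorem relabel_word {X Y : Type*} (f : X → Y) (w : List X) :
    relabel K f (word K w) = word K (w.map f) := by
  rw [relabel, lift_word, word, List.map_map]; rfl

theorem relabel_lieWord {X Y : Type*} (f : X → Y) (t : FreeMagma X) :
    relabel K f (toCommutators K X (lieWord K t)) =
      toCommutators K Y (lieWord K (FreeMagma.map f t)) := by
  induction t using FreeMagma.rec with
  | of x =>
    change relabel K f (toCommutators K X (FreeLieAlgebra.of K x)) =
      toCommutators K Y (FreeLieAlgebra.of K (f x))
    simp [toCommutators_of, relabel]
  | mul s t hs ht =>
    change relabel K f (toCommutators K X ⁅lieWord K s, lieWord K t⁆) = toCommutators K Y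
      ⁅lieWord K (FreeMagma.map f s), lieWord K (FreeMagma.map f t)⁆
    rw [toCommutators_lie, toCommutators_lie, map_sub, map_mul, map_mul, hs, ht]

theorem daggerAux_eq_relabel (k : ℕ) (p : FreeAlgebra K (Fin k)) :
    daggerAux K k p = (-1 : K) ^ (k + 1) • relabel K Fin.rev p := by
  have h : daggerAux K k = (-1 : K) ^ (k + 1) • (relabel K Fin.rev).toLinearMap :=
    linearMap_ext_word K fun w => by
      rw [daggerAux, onWords_word, LinearMap.smul_apply, AlgHom.toLinearMap_apply, relabel_word]
  rw [h]; rfl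

variable {k : ℕ} [NeZero k]

/-- The bilinear map which takes a monomial `u k v`, with `k` not in `u`, and a polynomial `a` to
`(v + 1) a (u + 1)`. Up to the shift of the letters of `u` and `v`, this is the cyclic word
`a u k v` read from its letter `k`, which is left out. -/
noncomputable def rotateInsert :
    FreeAlgebra K (Fin k) →ₗ[K] FreeAlgebra K (Fin k) →ₗ[K] FreeAlgebra K (Fin k) :=
  onWords K fun w =>
    LinearMap.mulLeft K (word K ((w.dropWhile fun i => i ≠ ⊤).tail.map (· + 1))) ∘ₗ
      LinearMap.mulRight K (word K ((w.takeWhile fun i => i ≠ ⊤).map (· + 1)))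

theorem rotateInsert_word (u v : List (Fin k)) (hu : (⊤ : Fin k) ∉ u) (a : FreeAlgebra K (Fin k)) :
    rotateInsert K (word K (u ++ ⊤ :: v)) a =
      word K (v.map (· + 1)) * (a * word K (u.map (· + 1))) := by
  have h : ∀ a ∈ u, decide (a ≠ ⊤) = true := fun a ha => by
    simp only [decide_eq_true_eq]; rintro rfl; exact hu ha
  rw [rotateInsert, onWords_word, List.dropWhile_append_of_pos h, List.takeWhile_append_of_pos h]
  simp

theorem rotateInsert_ι_zero (p : FreeAlgebra K (Fin k)) :
    rotateInsert K p (FreeAlgebra.ι K 0) = rotateAux K k p := by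
  have h : (rotateInsert K).flip (FreeAlgebra.ι K (0 : Fin k)) = rotateAux K k :=
    linearMap_ext_word K fun w => by
      rw [LinearMap.flip_apply, rotateAux, onWords_word, rotateInsert, onWords_word, rotateWord,
        word_append, word_cons]
      simp
  rw [← h]; rfl

theorem rotateInsert_mul_left {l l' : List (Fin k)} (hl : (⊤ : Fin k) ∉ l) (hl' : (⊤ : Fin k) ∈ l')
    {p q : FreeAlgebra K (Fin k)} (hp : p ∈ permSpan K l) (hq : q ∈ permSpan K l')
    (a : FreeAlgebra K (Fin k)) :
    rotateInsert K (p * q) a = rotateInsert K q (a * relabel K (· + 1) p) := by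
  refine eq_of_mem_permSpan
    (f := (rotateInsert K).flip a ∘ₗ LinearMap.mulRight K q)
    (g := rotateInsert K q ∘ₗ LinearMap.mulLeft K a ∘ₗ (relabel K (· + 1)).toLinearMap)
    (fun x hx => ?_) hp
  refine eq_of_mem_permSpan
    (f := (rotateInsert K).flip a ∘ₗ LinearMap.mulLeft K (word K x))
    (g := (rotateInsert K).flip (a * relabel K (· + 1) (word K x))) (fun w hw => ?_) hq
  obtain ⟨u, v, rfl, hu⟩ := List.eq_append_cons_of_mem (hw.mem_iff.2 hl')
  have hx' : (⊤ : Fin k) ∉ x ++ u := by simp [hx.mem_iff, hl, hu]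
  simp only [LinearMap.comp_apply, LinearMap.mulLeft_apply, LinearMap.flip_apply]
  rw [← word_append, ← List.append_assoc, rotateInsert_word K _ _ hx', rotateInsert_word K _ _ hu,
    relabel_word, List.map_append, word_append]
  simp only [mul_assoc]

theorem rotateInsert_mul_right {l l' : List (Fin k)} (hl' : (⊤ : Fin k) ∈ l')
    {p q : FreeAlgebra K (Fin k)} (hp : p ∈ permSpan K l) (hq : q ∈ permSpan K l')
    (a : FreeAlgebra K (Fin k)) :
    rotateInsert K (q * p) a = rotateInsert K q (relabel K (· + 1) p * a) := by
  refine eq_of_mem_permSpan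
    (f := (rotateInsert K).flip a ∘ₗ LinearMap.mulLeft K q)
    (g := rotateInsert K q ∘ₗ LinearMap.mulRight K a ∘ₗ (relabel K (· + 1)).toLinearMap)
    (fun x hx => ?_) hp
  refine eq_of_mem_permSpan
    (f := (rotateInsert K).flip a ∘ₗ LinearMap.mulRight K (word K x))
    (g := (rotateInsert K).flip (relabel K (· + 1) (word K x) * a)) (fun w hw => ?_) hq
  obtain ⟨u, v, rfl, hu⟩ := List.eq_append_cons_of_mem (hw.mem_iff.2 hl')
  simp only [LinearMap.comp_apply, LinearMap.mulRight_apply, LinearMap.flip_apply]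
  rw [← word_append, List.append_assoc, List.cons_append, rotateInsert_word K _ _ hu,
    rotateInsert_word K _ _ hu, relabel_word, List.map_append, word_append]
  simp only [mul_assoc]

/-- The root of a bracket expression can be moved to its leaf `k`. The invariance
`⟨a, [s, t]⟩ = ⟨[a, s], t⟩` of the trace form moves it one step towards that leaf; the expression
`s` below stands for the part of the tree which has been passed so far. -/
theorem exists_reroot (t : FreeMagma (Fin k)) (ht : (leaves t).count ⊤ = 1)
    (s : FreeMagma (Fin k)) :
    ∃ t', (leaves t').Perm (leaves s ++ ((leaves t).erase ⊤).map (· + 1)) ∧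
      rotateInsert K (toCommutators K _ (lieWord K t)) (toCommutators K _ (lieWord K s)) =
        toCommutators K _ (lieWord K t') := by
  induction t using FreeMagma.rec generalizing s with
  | of x =>
    have hx : x = ⊤ := by
      by_contra h
      simp [leaves, h] at ht
    subst hx
    refine ⟨s, by simp [leaves], ?_⟩
    rw [lieWord, toCommutators_of, show FreeAlgebra.ι K (⊤ : Fin k) = word K ([] ++ ⊤ :: []) by
      simp [word], rotateInsert_word K _ _ (by simp)]
    simp [word_nil]
  | mul t₁ t₂ h₁ h₂ =>
    rw [leaves, List.count_append] at ht
    have m₁ := lieWord_mem_permSpan K t₁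
    have m₂ := lieWord_mem_permSpan K t₂
    rw [lieWord, toCommutators_lie, map_sub, LinearMap.sub_apply, leaves]
    by_cases hc : (leaves t₁).count ⊤ = 0
    · have n₁ : (⊤ : Fin k) ∉ leaves t₁ := List.count_eq_zero.1 hc
      have n₂ : (⊤ : Fin k) ∈ leaves t₂ := List.count_pos_iff.1 (by omega)
      obtain ⟨t', hp, he⟩ := h₂ (by omega) (.mul s (FreeMagma.map (· + 1) t₁))
      refine ⟨t', hp.trans ?_, ?_⟩
      · rw [leaves, leaves_map, List.erase_append_right _ n₁, List.map_append, List.append_assoc]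
      · rw [rotateInsert_mul_left K n₁ n₂ m₁ m₂, rotateInsert_mul_right K n₂ m₁ m₂, ← map_sub,
          relabel_lieWord, ← toCommutators_lie]
        exact he
    · have n₁ : (⊤ : Fin k) ∈ leaves t₁ := List.count_pos_iff.1 (by omega)
      have n₂ : (⊤ : Fin k) ∉ leaves t₂ := List.count_eq_zero.1 (by omega)
      obtain ⟨t', hp, he⟩ := h₁ (by omega) (.mul (FreeMagma.map (· + 1) t₂) s)
      refine ⟨t', hp.trans ?_, ?_⟩
      · rw [leaves, leaves_map, List.erase_append_left _ n₁, List.map_append, List.append_assoc]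
        refine List.perm_append_comm.trans ?_
        rw [List.append_assoc]
      · rw [rotateInsert_mul_right K n₁ m₂ m₁, rotateInsert_mul_left K n₂ n₁ m₂ m₁, ← map_sub,
          relabel_lieWord, ← toCommutators_lie]
        exact he

theorem exists_rotate_lieWord {t : FreeMagma (Fin k)} (ht : (leaves t).Perm (List.finRange k)) :
    ∃ t', (leaves t').Perm (List.finRange k) ∧
      rotateAux K k (toCommutators K _ (lieWord K t)) = toCommutators K _ (lieWord K t') := by
  have hc : (leaves t).count ⊤ = 1 := by
    rw [ht.count_eq, List.count_eq_one_of_mem (List.nodup_finRange k) (List.mem_finRange _)]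
  obtain ⟨t', hp, he⟩ := exists_reroot K t hc (.of 0)
  refine ⟨t', hp.trans ?_, ?_⟩
  · have h0 : (⊤ : Fin k) + 1 = 0 := by
      obtain ⟨n, rfl⟩ := Nat.exists_eq_succ_of_ne_zero (NeZero.ne k)
      exact Fin.last_add_one n
    have hm : (⊤ : Fin k) ∈ leaves t := ht.mem_iff.2 (List.mem_finRange _)
    have := ((List.perm_cons_erase hm).map (· + 1)).symm
    rw [List.map_cons, h0] at this
    exact this.trans (perm_of_map (Equiv.addRight (1 : Fin k)) ht)
  · rw [← he, lieWord, toCommutators_of, rotateInsert_ι_zero]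

end LieMonomials

/-! ### The dihedral action on multilinear Lie polynomials -/

section DihedralLie

/-- A subspace stable under a representation carries a representation; here the subspace is given
by an injective linear map. -/
theorem exists_representation_of_injective {K G V W : Type*} [Field K] [Group G] [AddCommGroup V]
    [Module K V] [AddCommGroup W] [Module K W] (ρ : Representation K G V) (i : W →ₗ[K] V)
    (hi : Function.Injective i) (h : ∀ g x, ∃ y, i y = ρ g (i x)) :
    ∃ ρ' : Representation K G W, ∀ g x, i (ρ' g x) = ρ g (i x) := by
  choose f hf using h
  refine ⟨{ toFun := fun g =>
              { toFun := f g
                map_add' := fun x y => hi (by simp [hf])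
                map_smul' := fun c x => hi (by simp [hf]) }
            map_one' := LinearMap.ext fun x => hi (by simp [hf])
            map_mul' := fun g g' => LinearMap.ext fun x => hi (by simp [hf]) }, hf⟩

variable (K : Type*) [Field K] {k : ℕ} [NeZero k]

theorem lieWord_mem {k : ℕ} {t : FreeMagma (Fin k)} (ht : (leaves t).Perm (List.finRange k)) :
    lieWord K t ∈ lieMultilinear K k := Submodule.subset_span ⟨t, ht, Or.inl rfl⟩

theorem exists_lieMonomial {ρ : Representation K (DihedralGroup (k + 1)) (multilinear K k)}
    (hr : ρ (DihedralGroup.r 1) = rotate K k) (hs : ρ (DihedralGroup.sr 0) = dagger K k)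
    (g : DihedralGroup (k + 1)) :
    ∀ x : lieMultilinear K k, (x : FreeLieAlgebra K (Fin k)) ∈ lieMonomials K k →
      ∃ y : lieMultilinear K k, (y : FreeLieAlgebra K (Fin k)) ∈ lieMonomials K k ∧
        lieInclusion K k y = ρ g (lieInclusion K k x) := by
  have neg_mem : ∀ y : lieMultilinear K k, (y : FreeLieAlgebra K (Fin k)) ∈ lieMonomials K k →
      ((-y : lieMultilinear K k) : FreeLieAlgebra K (Fin k)) ∈ lieMonomials K k := by
    rintro y ⟨t, ht, h | h⟩
    · exact ⟨t, ht, Or.inr (by simp [h])⟩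
    · exact ⟨t, ht, Or.inl (by simp [h])⟩
  -- It suffices to treat monomials with positive sign.
  have reduce : ∀ g, (∀ t (ht : (leaves t).Perm (List.finRange k)),
      ∃ y : lieMultilinear K k, (y : FreeLieAlgebra K (Fin k)) ∈ lieMonomials K k ∧
        lieInclusion K k y = ρ g (lieInclusion K k ⟨lieWord K t, lieWord_mem K ht⟩)) →
      ∀ x : lieMultilinear K k, (x : FreeLieAlgebra K (Fin k)) ∈ lieMonomials K k →
      ∃ y : lieMultilinear K k, (y : FreeLieAlgebra K (Fin k)) ∈ lieMonomials K k ∧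
        lieInclusion K k y = ρ g (lieInclusion K k x) := by
    rintro g h x ⟨t, ht, hx⟩
    obtain ⟨y, hy, he⟩ := h t ht
    rcases hx with hx | hx
    · exact ⟨y, hy, by rw [he]; congr 2; exact Subtype.ext hx.symm⟩
    · refine ⟨-y, neg_mem y hy, ?_⟩
      rw [map_neg, he, ← map_neg, ← map_neg]
      congr 2
      exact Subtype.ext hx.symm
  induction g using dihedralGroup_induction with
  | h1 => exact fun x hx => ⟨x, hx, by simp⟩
  | hr =>
    refine reduce _ fun t ht => ?_
    obtain ⟨t', ht', he⟩ := exists_rotate_lieWord K ht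
    refine ⟨⟨lieWord K t', lieWord_mem K ht'⟩, ⟨t', ht', Or.inl rfl⟩, Subtype.ext ?_⟩
    rw [hr, rotate, LinearMap.coe_restrict_apply, coe_lieInclusion, coe_lieInclusion, he]
  | hs =>
    refine reduce _ fun t ht => ?_
    have ht' : (leaves (FreeMagma.map Fin.rev t)).Perm (List.finRange k) := by
      rw [leaves_map]
      exact perm_of_map Fin.revPerm ht
    refine ⟨⟨(-1 : K) ^ (k + 1) • lieWord K (FreeMagma.map Fin.rev t),
      Submodule.smul_mem _ _ (lieWord_mem K ht')⟩, ⟨_, ht', ?_⟩, Subtype.ext ?_⟩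
    · rcases neg_one_pow_eq_or K (k + 1) with h | h
      · exact Or.inl (by simp only [h, one_smul])
      · exact Or.inr (by simp only [h, neg_one_smul])
    · rw [hs, dagger, LinearMap.coe_restrict_apply, coe_lieInclusion, coe_lieInclusion,
        daggerAux_eq_relabel, relabel_lieWord, map_smul]
  | hmul g g' hg hg' =>
    intro x hx
    obtain ⟨y, hy, he⟩ := hg' x hx
    obtain ⟨z, hz, he'⟩ := hg y hy
    exact ⟨z, hz, by rw [he', he, map_mul, Module.End.mul_apply]⟩

theorem exists_lieInclusion_eq {ρ : Representation K (DihedralGroup (k + 1)) (multilinear K k)}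
    (hr : ρ (DihedralGroup.r 1) = rotate K k) (hs : ρ (DihedralGroup.sr 0) = dagger K k)
    (g : DihedralGroup (k + 1)) (x : lieMultilinear K k) :
    ∃ y, lieInclusion K k y = ρ g (lieInclusion K k x) := by
  obtain ⟨x, hx⟩ := x
  refine Submodule.span_induction
    (p := fun x hx => ∃ y, lieInclusion K k y = ρ g (lieInclusion K k ⟨x, hx⟩)) ?_ ?_ ?_ ?_ hx
  · intro x hx
    obtain ⟨y, _, he⟩ := exists_lieMonomial K hr hs g ⟨x, Submodule.subset_span hx⟩ hx
    exact ⟨y, he⟩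
  · exact ⟨0, by rw [map_zero, show (⟨0, zero_mem _⟩ : lieMultilinear K k) = 0 from rfl, map_zero,
      map_zero]⟩
  · rintro x y hx hy ⟨x', hx'⟩ ⟨y', hy'⟩
    exact ⟨x' + y', by rw [map_add, hx', hy', ← map_add, ← map_add]; rfl⟩
  · rintro c x hx ⟨x', hx'⟩
    exact ⟨c • x', by rw [map_smul, hx', ← map_smul, ← map_smul]; rfl⟩

end DihedralLie

/-! ### The sum of the coefficients -/

section CoefficientSum

variable {X : Type*} [LinearOrder X]

/-- Inserting a letter smaller than all others behind the first letter `y`: at a descent it creates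
one more ascent, and at an ascent or at the end one more descent. -/
theorem sum_map_insertions {M : Type*} [CommSemiring M] (g : ℕ → ℕ → M) (t y : X) (ys : List X)
    (h : ∀ x ∈ y :: ys, t < x) :
    ((List.permutations'Aux t ys).map fun l => g (ascents (y :: l)) (descents (y :: l))).sum =
      descents (y :: ys) * g (ascents (y :: ys) + 1) (descents (y :: ys)) +
        (ascents (y :: ys) + 1) * g (ascents (y :: ys)) (descents (y :: ys) + 1) := by
  induction ys generalizing y g with
  | nil => simp [ascents, descents, not_lt_of_gt (h y (by simp))]
  | cons z ys ih =>
    have hy := h y (by simp)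
    have hz := h z (by simp)
    have ih := fun g => ih g z fun x hx => h x (by simp [List.mem_cons.1 hx])
    rw [List.permutations'Aux, List.map_cons, List.sum_cons, List.map_map]
    have e : ((fun l => g (ascents (y :: l)) (descents (y :: l))) ∘ List.cons z) = fun l =>
        g ((if y < z then 1 else 0) + ascents (z :: l))
          ((if y < z then 0 else 1) + descents (z :: l)) := by
      funext l; simp only [Function.comp_apply, ascents, descents]
    rw [e, ih fun p q => g ((if y < z then 1 else 0) + p) ((if y < z then 0 else 1) + q)]
    simp only [ascents, descents, hz, not_lt_of_gt hy, if_true, if_false]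
    split_ifs
    · simp only [zero_add]
      rw [show 1 + (ascents (z :: ys) + 1) = 1 + ascents (z :: ys) + 1 by ring,
        show 1 + descents (z :: ys) = descents (z :: ys) + 1 by ring]
      push_cast
      ring
    · simp only [zero_add]
      rw [show 1 + ascents (z :: ys) = ascents (z :: ys) + 1 by ring,
        show 1 + (descents (z :: ys) + 1) = 1 + descents (z :: ys) + 1 by ring]
      push_cast
      ring

theorem sum_insertions_magnusCoeff (K : Type*) [Field K] (t : X) {v : List X} (hv : v ≠ [])
    (h : ∀ x ∈ v, t < x) :
    ((List.permutations'Aux t v).map (magnusCoeff K)).sum = 0 := by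
  rcases v with _ | ⟨y, ys⟩
  · exact absurd rfl hv
  · have key := sum_map_insertions (magnusNumber K) t y ys h
    rw [List.permutations'Aux, List.map_cons, List.sum_cons, List.map_map]
    change magnusCoeff K (t :: y :: ys) + ((List.permutations'Aux t ys).map fun l =>
      magnusNumber K (ascents (y :: l)) (descents (y :: l))).sum = 0
    rw [key, magnusCoeff, (ascents_cons_of_lt h).1, (ascents_cons_of_lt h).2,
      if_neg (List.cons_ne_nil y ys)]
    linear_combination magnusNumber_insertion K (ascents (y :: ys)) (descents (y :: ys))

/-- For at least two commuting variables the Magnus commutator vanishes. -/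
theorem sum_magnusCoeff (K : Type*) [Field K] (k : ℕ) :
    ∑ w ∈ permWords (k + 2), magnusCoeff K w = 0 := by
  have hnd : (List.finRange (k + 2)).permutations'.Nodup :=
    (List.permutations_perm_permutations' _).nodup_iff.1
      (List.nodup_permutations _ (List.nodup_finRange _))
  rw [permWords, List.sum_toFinset _ hnd, List.finRange_succ, List.permutations']
  have zero : ∀ L : List (List (Fin (k + 2))),
      (∀ v ∈ L, ((List.permutations'Aux 0 v).map (magnusCoeff K)).sum = 0) →
      ((L.flatMap (List.permutations'Aux 0)).map (magnusCoeff K)).sum = 0 := by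
    intro L hL
    induction L with
    | nil => simp
    | cons v L ih =>
      rw [List.flatMap_cons, List.map_append, List.sum_append, hL v (by simp),
        ih fun u hu => hL u (by simp [hu]), add_zero]
  refine zero _ fun v hv => ?_
  rw [List.mem_permutations'] at hv
  refine sum_insertions_magnusCoeff K 0 ?_ fun x hx => ?_
  · rintro rfl
    simpa using hv.length_eq
  · obtain ⟨y, _, rfl⟩ := List.mem_map.1 (hv.mem_iff.1 hx)
    exact Fin.succ_pos y

end CoefficientSum

/-! ### Exchanging two neighbouring variables -/

section Exchange

variable {k : ℕ}

/-- Replacing the letter `i` by the two letters `p q`; the letters different from `i` are renumbered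
so as to leave out `i + 1`. -/
def doubleLetter (i : Fin k) (p q : Fin (k + 1)) (v : List (Fin k)) : List (Fin (k + 1)) :=
  v.flatMap fun j => if j = i then [p, q] else [i.succ.succAbove j]

theorem doubleLetter_of_notMem {i : Fin k} {p q : Fin (k + 1)} {v : List (Fin k)} (h : i ∉ v) :
    doubleLetter i p q v = v.map i.succ.succAbove := by
  induction v with
  | nil => rfl
  | cons j v ih =>
    rw [List.mem_cons, not_or] at h
    rw [doubleLetter, List.flatMap_cons, if_neg (Ne.symm h.1), ← doubleLetter, ih h.2]
    rfl

theorem doubleLetter_append_cons {i : Fin k} {p q : Fin (k + 1)} {u z : List (Fin k)} (hu : i ∉ u)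
    (hz : i ∉ z) : doubleLetter i p q (u ++ i :: z) =
      u.map i.succ.succAbove ++ p :: q :: z.map i.succ.succAbove := by
  rw [doubleLetter, List.flatMap_append, List.flatMap_cons, ← doubleLetter, ← doubleLetter,
    doubleLetter_of_notMem hu, doubleLetter_of_notMem hz, if_pos rfl]
  rfl

theorem swap_lt_swap_iff (i : Fin k) {x y : Fin (k + 1)} (h : ¬ (x = i.castSucc ∧ y = i.succ))
    (h' : ¬ (x = i.succ ∧ y = i.castSucc)) :
    Equiv.swap i.castSucc i.succ x < Equiv.swap i.castSucc i.succ y ↔ x < y := by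
  simp only [Fin.ext_iff, Fin.val_castSucc, Fin.val_succ] at h h'
  simp only [Equiv.swap_apply_def, Fin.ext_iff, Fin.val_castSucc, Fin.val_succ, Fin.lt_def]
  split_ifs <;> simp only [Fin.val_castSucc, Fin.val_succ] <;> omega

theorem isChain_of_not_consecutive {X : Type*} {a b : X} {w : List X}
    (h : ∀ u z, w ≠ u ++ a :: b :: z) (h' : ∀ u z, w ≠ u ++ b :: a :: z) :
    w.IsChain fun x y => ¬ (x = a ∧ y = b) ∧ ¬ (x = b ∧ y = a) := by
  induction w with
  | nil => exact .nil
  | cons c w ih =>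
    rcases w with _ | ⟨d, w⟩
    · exact .singleton _
    · refine List.isChain_cons_cons.2 ⟨⟨?_, ?_⟩, ih (fun u z hu => h (c :: u) z (by rw [hu]; rfl))
        fun u z hu => h' (c :: u) z (by rw [hu]; rfl)⟩
      · rintro ⟨rfl, rfl⟩; exact h [] w rfl
      · rintro ⟨rfl, rfl⟩; exact h' [] w rfl

theorem succAbove_succ_of_ne {i j : Fin k} (h : j ≠ i) :
    i.succ.succAbove j ≠ i.castSucc ∧ i.succ.succAbove j ≠ i.succ := by
  refine ⟨fun he => h ?_, Fin.succAbove_ne _ _⟩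
  rw [← Fin.succAbove_succ_self i] at he
  exact Fin.succAbove_right_injective he

theorem map_swap_map_succAbove {i : Fin k} {l : List (Fin k)} (hl : i ∉ l) :
    (l.map i.succ.succAbove).map (Equiv.swap i.castSucc i.succ) = l.map i.succ.succAbove := by
  rw [List.map_map]
  refine List.map_congr_left fun j hj => ?_
  have := succAbove_succ_of_ne (i := i) (j := j) (by rintro rfl; exact hl hj)
  exact Equiv.swap_apply_of_ne_of_ne this.1 this.2

theorem map_swap_doubleLetter {i : Fin k} {v : List (Fin k)} (hv : v ∈ permWords k) :
    (doubleLetter i i.castSucc i.succ v).map (Equiv.swap i.castSucc i.succ) =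
      doubleLetter i i.succ i.castSucc v := by
  obtain ⟨u, z, rfl, hu, hz⟩ := exists_eq_append_cons_of_mem_permWords hv i
  rw [doubleLetter_append_cons hu hz, doubleLetter_append_cons hu hz, List.map_append,
    List.map_cons, List.map_cons, map_swap_map_succAbove hu, map_swap_map_succAbove hz,
    Equiv.swap_apply_left, Equiv.swap_apply_right]

theorem ascents_doubleLetter {i : Fin k} {v : List (Fin k)} (hv : v ∈ permWords k) :
    (ascents (doubleLetter i i.castSucc i.succ v) = ascents v + 1 ∧
      descents (doubleLetter i i.castSucc i.succ v) = descents v) ∧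
    (ascents (doubleLetter i i.succ i.castSucc v) = ascents v ∧
      descents (doubleLetter i i.succ i.castSucc v) = descents v + 1) := by
  obtain ⟨u, z, rfl, hu, hz⟩ := exists_eq_append_cons_of_mem_permWords hv i
  have mono := ascents_map i.succ.succAbove (l := u ++ i :: z)
    (isChain_of_forall_mem fun x _ y _ => (Fin.strictMono_succAbove _).lt_iff_lt)
  rw [List.map_append, List.map_cons, Fin.succAbove_succ_self] at mono
  rw [doubleLetter_append_cons hu hz, doubleLetter_append_cons hu hz]
  have hu' := map_swap_map_succAbove hu
  have hz' := map_swap_map_succAbove hz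
  have nu : ∀ x ∈ u.map i.succ.succAbove, x ≠ i.castSucc ∧ x ≠ i.succ := by
    intro x hx
    obtain ⟨j, hj, rfl⟩ := List.mem_map.1 hx
    exact succAbove_succ_of_ne (by rintro rfl; exact hu hj)
  have nz : ∀ x ∈ z.map i.succ.succAbove, x ≠ i.castSucc ∧ x ≠ i.succ := by
    intro x hx
    obtain ⟨j, hj, rfl⟩ := List.mem_map.1 hx
    exact succAbove_succ_of_ne (by rintro rfl; exact hz hj)
  generalize u.map i.succ.succAbove = u' at *
  generalize z.map i.succ.succAbove = z' at *
  have hne : i.castSucc ≠ i.succ := Fin.castSucc_lt_succ.ne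
  -- The other letters compare in the same way with both of the letters in question.
  have s1 := ascents_map (Equiv.swap i.castSucc i.succ) (l := u' ++ [i.castSucc])
    (isChain_of_forall_mem fun x hx y hy => swap_lt_swap_iff i (by grind) (by grind))
  have s2 := ascents_map (Equiv.swap i.castSucc i.succ) (l := i.castSucc :: z')
    (isChain_of_forall_mem fun x hx y hy => swap_lt_swap_iff i (by grind) (by grind))
  rw [List.map_append, hu', List.map_singleton, Equiv.swap_apply_left] at s1
  rw [List.map_cons, hz', Equiv.swap_apply_left] at s2
  rw [ascents_append_cons, descents_append_cons] at mono
  have hlt : i.castSucc < i.succ := Fin.castSucc_lt_succ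
  have c1 : ascents (i.castSucc :: i.succ :: z') = ascents (i.succ :: z') + 1 ∧
      descents (i.castSucc :: i.succ :: z') = descents (i.succ :: z') := by
    simp only [ascents, descents, hlt, if_true]; omega
  have c2 : ascents (i.succ :: i.castSucc :: z') = ascents (i.castSucc :: z') ∧
      descents (i.succ :: i.castSucc :: z') = descents (i.castSucc :: z') + 1 := by
    simp only [ascents, descents, hlt.not_gt, if_false]; omega
  rw [ascents_append_cons u' i.castSucc, descents_append_cons u' i.castSucc,
    ascents_append_cons u' i.succ, descents_append_cons u' i.succ]
  omega

theorem filter_doubleLetter (i : Fin k) (v : List (Fin k)) :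
    (doubleLetter i i.castSucc i.succ v).filter (· ≠ i.succ) = v.map i.succ.succAbove ∧
      (doubleLetter i i.succ i.castSucc v).filter (· ≠ i.succ) = v.map i.succ.succAbove := by
  have hne : i.castSucc ≠ i.succ := Fin.castSucc_lt_succ.ne
  induction v with
  | nil => exact ⟨rfl, rfl⟩
  | cons j v ih =>
    simp only [doubleLetter, List.flatMap_cons, List.filter_append, List.map_cons] at ih ⊢
    rw [ih.1, ih.2]
    by_cases h : j = i
    · subst h
      simp [hne, Fin.succAbove_succ_self]
    · simp [h, Fin.succAbove_ne]

theorem doubleLetter_injective (i : Fin k) :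
    Function.Injective (doubleLetter i i.castSucc i.succ) ∧
      Function.Injective (doubleLetter i i.succ i.castSucc) := by
  have inj := List.map_injective_iff.2 (Fin.succAbove_right_injective (p := i.succ))
  refine ⟨fun v w h => inj ?_, fun v w h => inj ?_⟩
  · rw [← (filter_doubleLetter i v).1, h, (filter_doubleLetter i w).1]
  · rw [← (filter_doubleLetter i v).2, h, (filter_doubleLetter i w).2]

theorem doubleLetter_mem {i : Fin k} {v : List (Fin k)} (hv : v ∈ permWords k) :
    doubleLetter i i.castSucc i.succ v ∈ permWords (k + 1) := by
  obtain ⟨hnd, hmem⟩ := mem_permWords_iff_nodup.1 hv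
  have hlen := length_of_mem_permWords hv
  have hall : ∀ x, x ∈ doubleLetter i i.castSucc i.succ v := by
    intro x
    by_cases hx : x = i.succ
    · subst hx
      exact List.mem_flatMap.2 ⟨i, hmem i, by simp⟩
    · obtain ⟨j, rfl⟩ := Fin.exists_succAbove_eq hx
      by_cases hj : j = i
      · subst hj
        exact List.mem_flatMap.2 ⟨j, hmem j, by simp [Fin.succAbove_succ_self]⟩
      · exact List.mem_flatMap.2 ⟨j, hmem j, by simp [hj]⟩
  refine mem_permWords_iff_nodup.2 ⟨?_, hall⟩
  obtain ⟨u, z, rfl, hu, hz⟩ := exists_eq_append_cons_of_mem_permWords hv i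
  have hperm : (doubleLetter i i.castSucc i.succ (u ++ i :: z)).Perm
      (i.succ :: (u ++ i :: z).map i.succ.succAbove) := by
    rw [doubleLetter_append_cons hu hz, List.map_append, List.map_cons, Fin.succAbove_succ_self]
    simpa only [List.append_assoc, List.cons_append, List.nil_append] using
      List.perm_middle (a := i.succ) (l₁ := u.map i.succ.succAbove ++ [i.castSucc])
        (l₂ := z.map i.succ.succAbove)
  refine hperm.nodup_iff.2 (List.nodup_cons.2 ⟨?_, hnd.map Fin.succAbove_right_injective⟩)
  intro h
  obtain ⟨j, _, hj⟩ := List.mem_map.1 h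
  exact Fin.succAbove_ne _ _ hj

theorem map_perm_mem_permWords {k : ℕ} (σ : Equiv.Perm (Fin k)) {w : List (Fin k)}
    (hw : w ∈ permWords k) : w.map σ ∈ permWords k :=
  mem_permWords.2 (perm_of_map σ (mem_permWords.1 hw))

theorem sum_permWords_map_perm {k : ℕ} {V : Type*} [AddCommMonoid V] (σ : Equiv.Perm (Fin k))
    (f : List (Fin k) → V) : ∑ w ∈ permWords k, f (w.map σ) = ∑ w ∈ permWords k, f w :=
  Finset.sum_bij' (fun w _ => w.map σ) (fun w _ => w.map σ.symm)
    (fun w hw => map_perm_mem_permWords σ hw) (fun w hw => map_perm_mem_permWords σ.symm hw)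
    (fun w _ => by simp [Function.comp_def]) (fun w _ => by simp [Function.comp_def])
    (fun w _ => rfl)

/-- A word in which the letters `i, i + 1` are consecutive, in this order, comes from a word with
one letter less. -/
theorem exists_doubleLetter_eq {i : Fin k} {p q : Fin (k + 1)} {u z : List (Fin (k + 1))}
    (hpq : (p = i.castSucc ∧ q = i.succ) ∨ (p = i.succ ∧ q = i.castSucc))
    (hw : u ++ p :: q :: z ∈ permWords (k + 1)) :
    ∃ v ∈ permWords k, doubleLetter i p q v = u ++ p :: q :: z := by
  obtain ⟨hnd, hmem⟩ := mem_permWords_iff_nodup.1 hw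
  have hne : i.castSucc ≠ i.succ := Fin.castSucc_lt_succ.ne
  have hnb : ∀ x ∈ u ++ i.castSucc :: z, x ≠ i.succ := by
    rw [List.nodup_append, List.nodup_cons, List.nodup_cons] at hnd
    intro x hx
    rw [List.mem_append, List.mem_cons] at hx
    grind
  have hsub : (u ++ i.castSucc :: z).Sublist (u ++ p :: q :: z) := by
    refine List.Sublist.append (List.Sublist.refl u) ?_
    rcases hpq with ⟨rfl, rfl⟩ | ⟨rfl, rfl⟩
    · exact (List.sublist_cons_self _ _).cons_cons _
    · exact List.sublist_cons_self _ _
  obtain ⟨v, hv⟩ : u ++ i.castSucc :: z ∈ Set.range (List.map i.succ.succAbove) := by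
    rw [Set.range_list_map]
    intro x hx
    exact Fin.exists_succAbove_eq (hnb x hx)
  have hvnd : v.Nodup := List.Nodup.of_map _ (by rw [hv]; exact hnd.sublist hsub)
  refine ⟨v, mem_permWords_iff_nodup.2 ⟨hvnd, fun j => ?_⟩, ?_⟩
  · have hj : i.succ.succAbove j ∈ u ++ i.castSucc :: z := by
      have h1 := hmem (i.succ.succAbove j)
      have h2 := Fin.succAbove_ne i.succ j
      rw [List.mem_append, List.mem_cons, List.mem_cons] at h1
      rw [List.mem_append, List.mem_cons]
      grind
    rw [← hv] at hj
    exact (List.mem_map_of_injective Fin.succAbove_right_injective).1 hj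
  · obtain ⟨v₁, v₂, rfl, rfl, h₂⟩ := List.map_eq_append_iff.1 hv
    obtain ⟨j, v₃, rfl, hj, rfl⟩ := List.map_eq_cons_iff.1 h₂
    have hji : j = i := by
      rw [← Fin.succAbove_succ_self i] at hj
      exact Fin.succAbove_right_injective hj
    subst hji
    rw [List.nodup_append, List.nodup_cons] at hvnd
    exact doubleLetter_append_cons (fun h => hvnd.2.2 _ h _ (by simp) rfl) hvnd.2.1.1

variable (K : Type*) [Field K] [CharZero K] {A : Type*} [Ring A] [Algebra K A]

/-- The polynomial `∑ w, c(w) x_w` over all words with every letter once, with the coefficients of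
the Magnus commutator. -/
noncomputable def magnusSum {k : ℕ} (x : Fin k → A) : A :=
  ∑ w ∈ permWords k, magnusCoeff K w • (w.map x).prod

/-- Exchanging two neighbouring variables changes the Magnus commutator by the Magnus commutator in
one variable less, in which the commutator of the two is inserted. -/
theorem magnusSum_sub_swap (i : Fin k) (x : Fin (k + 1) → A) :
    magnusSum K x - magnusSum K (x ∘ Equiv.swap i.castSucc i.succ) =
      magnusSum K fun j => if j = i then x i.castSucc * x i.succ - x i.succ * x i.castSucc
        else x (i.succ.succAbove j) := by
  classical
  set s := Equiv.swap i.castSucc i.succ with hs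
  set ab := doubleLetter i i.castSucc i.succ with hab
  set ba := doubleLetter i i.succ i.castSucc with hba
  have hss : ∀ w : List (Fin (k + 1)), (w.map s).map s = w := fun w => by
    simp [hs, Function.comp_def]
  have swap_ab : ∀ v ∈ permWords k, (ab v).map s = ba v := fun v hv => map_swap_doubleLetter hv
  have swap_ba : ∀ v ∈ permWords k, (ba v).map s = ab v := fun v hv => by
    rw [← swap_ab v hv, hss]
  have diff : ∀ v ∈ permWords k,
      magnusCoeff K (ab v) - magnusCoeff K (ba v) = magnusCoeff K v := by
    intro v hv
    obtain ⟨⟨h1, h2⟩, h3, h4⟩ := ascents_doubleLetter (i := i) hv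
    rw [magnusCoeff, magnusCoeff, h1, h2, h3, h4, magnusNumber_succ_sub, magnusCoeff]
  have lhs : magnusSum K x - magnusSum K (x ∘ s) = ∑ w ∈ permWords (k + 1),
      (magnusCoeff K w - magnusCoeff K (w.map s)) • (w.map x).prod := by
    rw [magnusSum, magnusSum, ← sum_permWords_map_perm s fun w =>
      magnusCoeff K w • (w.map (x ∘ s)).prod, ← Finset.sum_sub_distrib]
    refine Finset.sum_congr rfl fun w _ => ?_
    rw [← List.map_map, hss, sub_smul]
  have disj : Disjoint ((permWords k).image ab) ((permWords k).image ba) := by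
    rw [Finset.disjoint_left]
    intro w h1 h2
    obtain ⟨v, hv, rfl⟩ := Finset.mem_image.1 h1
    obtain ⟨v', hv', he⟩ := Finset.mem_image.1 h2
    have : v' = v := by
      have h := congrArg (List.filter (· ≠ i.succ)) he
      rw [(filter_doubleLetter i v').2, (filter_doubleLetter i v).1] at h
      exact List.map_injective_iff.2 Fin.succAbove_right_injective h
    subst this
    obtain ⟨u, z, rfl, hu, hz⟩ := exists_eq_append_cons_of_mem_permWords hv i
    rw [hab, hba, doubleLetter_append_cons hu hz, doubleLetter_append_cons hu hz,
      List.append_cancel_left_eq, List.cons_eq_cons] at he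
    exact Fin.castSucc_lt_succ.ne he.1.symm
  have sub : (permWords k).image ab ∪ (permWords k).image ba ⊆ permWords (k + 1) := by
    intro w hw
    rcases Finset.mem_union.1 hw with h | h <;> obtain ⟨v, hv, rfl⟩ := Finset.mem_image.1 h
    · exact doubleLetter_mem hv
    · rw [← swap_ab v hv]; exact map_perm_mem_permWords s (doubleLetter_mem hv)
  rw [lhs, ← Finset.sum_subset sub, Finset.sum_union disj,
    Finset.sum_image fun _ _ _ _ h => (doubleLetter_injective i).1 h,
    Finset.sum_image fun _ _ _ _ h => (doubleLetter_injective i).2 h, ← Finset.sum_add_distrib,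
    magnusSum]
  · refine Finset.sum_congr rfl fun v hv => ?_
    rw [swap_ab v hv, swap_ba v hv, diff v hv, ← neg_sub (magnusCoeff K (ab v)), diff v hv,
      neg_smul, ← sub_eq_add_neg, ← smul_sub]
    congr 1
    obtain ⟨u, z, rfl, hu, hz⟩ := exists_eq_append_cons_of_mem_permWords hv i
    have other : ∀ l : List (Fin k), i ∉ l →
        (l.map fun j => if j = i then x i.castSucc * x i.succ - x i.succ * x i.castSucc
          else x (i.succ.succAbove j)) = (l.map i.succ.succAbove).map x := by
      intro l hl
      rw [List.map_map]
      refine List.map_congr_left fun j hj => ?_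
      rw [if_neg (by rintro rfl; exact hl hj)]
      rfl
    rw [doubleLetter_append_cons hu hz, doubleLetter_append_cons hu hz]
    simp only [List.map_append, List.map_cons, List.prod_append, List.prod_cons, other u hu,
      other z hz, if_true]
    noncomm_ring
  · intro w hw hn
    rw [Finset.mem_union, not_or] at hn
    have chain := isChain_of_not_consecutive (a := i.castSucc) (b := i.succ) (w := w)
      (fun u z he => hn.1 (by
        subst he
        obtain ⟨v, hv, he⟩ := exists_doubleLetter_eq (Or.inl ⟨rfl, rfl⟩) hw
        exact Finset.mem_image.2 ⟨v, hv, he⟩))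
      (fun u z he => hn.2 (by
        subst he
        obtain ⟨v, hv, he⟩ := exists_doubleLetter_eq (Or.inr ⟨rfl, rfl⟩) hw
        exact Finset.mem_image.2 ⟨v, hv, he⟩))
    rw [magnusCoeff_map K s (chain.imp fun a b h => swap_lt_swap_iff i h.1 h.2), sub_self,
      zero_smul]

end Exchange

/-! ### The Magnus commutator is a Lie polynomial -/

section LiePolynomial

variable (K : Type*) [Field K] [CharZero K] {A : Type*} [Ring A] [Algebra K A]

theorem exists_perm_map_finRange {k : ℕ} {w : List (Fin k)} (hw : w ∈ permWords k) :
    ∃ τ : Equiv.Perm (Fin k), w = (List.finRange k).map τ := by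
  have hlen := length_of_mem_permWords hw
  have hnd := (mem_permWords_iff_nodup.1 hw).1
  have hinj : Function.Injective fun i : Fin k => w.get (Fin.cast hlen.symm i) :=
    (List.nodup_iff_injective_get.1 hnd).comp (Fin.cast_injective _)
  refine ⟨Equiv.ofBijective _ (Finite.injective_iff_bijective.1 hinj), ?_⟩
  refine List.ext_getElem (by simp [hlen]) fun n h1 h2 => ?_
  simp

/-- The symmetrization of the Magnus commutator in at least two variables vanishes. -/
theorem sum_magnusSum_perm (K : Type*) [Field K] {A : Type*} [Ring A] [Algebra K A] (k : ℕ)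
    (x : Fin (k + 2) → A) :
    ∑ σ : Equiv.Perm (Fin (k + 2)), magnusSum K (x ∘ σ) = 0 := by
  have const : ∀ w ∈ permWords (k + 2),
      ∑ σ : Equiv.Perm (Fin (k + 2)), (w.map (x ∘ σ)).prod =
        ∑ σ : Equiv.Perm (Fin (k + 2)), ((List.finRange (k + 2)).map (x ∘ σ)).prod := by
    intro w hw
    obtain ⟨τ, rfl⟩ := exists_perm_map_finRange hw
    rw [← Equiv.sum_comp (Equiv.mulRight τ) fun σ => ((List.finRange (k + 2)).map (x ∘ σ)).prod]
    refine Finset.sum_congr rfl fun σ _ => ?_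
    rw [List.map_map]
    rfl
  simp only [magnusSum]
  rw [Finset.sum_comm]
  simp only [← Finset.smul_sum]
  rw [Finset.sum_congr rfl fun w hw => by rw [const w hw], ← Finset.sum_smul, sum_magnusCoeff,
    zero_smul]

/-- Modulo Lie polynomials, the Magnus commutator is symmetric, since exchanging two neighbouring
variables changes it by a Lie polynomial; but its symmetrization vanishes. -/
theorem magnusSum_mem (L : Submodule K A) (hL : ∀ p ∈ L, ∀ q ∈ L, p * q - q * p ∈ L) (k : ℕ)
    (x : Fin (k + 1) → A) (hx : ∀ i, x i ∈ L) : magnusSum K x ∈ L := by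
  induction k with
  | zero =>
    have h : permWords 1 = {[0]} := by
      rw [permWords]; rfl
    rw [magnusSum, h, Finset.sum_singleton]
    simpa using L.smul_mem _ (hx 0)
  | succ k ih =>
    have key : ∀ (σ : Equiv.Perm (Fin (k + 2))) (x : Fin (k + 2) → A), (∀ i, x i ∈ L) →
        magnusSum K x - magnusSum K (x ∘ σ) ∈ L := by
      intro σ
      have hσ : σ ∈ Submonoid.closure
          (Set.range fun i : Fin (k + 1) => Equiv.swap i.castSucc i.succ) := by
        rw [Equiv.Perm.mclosure_swap_castSucc_succ]; trivial
      induction hσ using Submonoid.closure_induction with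
      | mem σ h =>
        obtain ⟨i, rfl⟩ := h
        intro x hx
        rw [magnusSum_sub_swap]
        refine ih _ fun j => ?_
        split_ifs
        · exact hL _ (hx _) _ (hx _)
        · exact hx _
      | one => intro x _; simp
      | mul σ τ _ _ h h' =>
        intro x hx
        have := add_mem (h x hx) (h' (x ∘ σ) fun i => hx _)
        rwa [sub_add_sub_cancel] at this
    have hsum := sum_mem fun (σ : Equiv.Perm (Fin (k + 2))) (_ : σ ∈ Finset.univ) => key σ x hx
    rw [Finset.sum_sub_distrib, sum_magnusSum_perm, sub_zero, Finset.sum_const, Finset.card_univ,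
      Fintype.card_perm, Fintype.card_fin, ← Nat.cast_smul_eq_nsmul K] at hsum
    exact (L.smul_mem_iff (Nat.cast_ne_zero.2 (Nat.factorial_ne_zero _))).1 hsum

theorem magnusPoly_mem_multilinear (k : ℕ) [NeZero k] : magnusPoly K k ∈ multilinear K k := by
  rw [magnusPoly_eq]
  exact sum_mem fun w hw => Submodule.smul_mem _ _ (word_mem_multilinear K hw)

theorem magnusPoly_mem_lieSpan (k : ℕ) [NeZero k] : magnusPoly K k ∈ lieSpan K (Fin k) := by
  obtain ⟨n, rfl⟩ := Nat.exists_eq_succ_of_ne_zero (NeZero.ne k)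
  rw [← magnus_ι, magnus_eq]
  exact magnusSum_mem K _ (fun p hp q hq => commutator_mem_lieSpan K hp hq) n _
    fun i => ι_mem_lieSpan K i

theorem exists_lieInclusion_eq_magnusPoly (k : ℕ) [NeZero k] :
    ∃ μLie : lieMultilinear K k, (lieInclusion K k μLie : FreeAlgebra K (Fin k)) = magnusPoly K k :=
  ⟨⟨dynkin K 0 (magnusPoly K k), dynkin_mem K 0 (magnusPoly_mem_multilinear K k)⟩,
    toCommutators_dynkin K 0 (magnusPoly_mem_multilinear K k) (magnusPoly_mem_lieSpan K k)⟩

theorem magnusPoly_invariant {k : ℕ} [NeZero k]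
    {ρ : Representation K (DihedralGroup (k + 1)) (multilinear K k)}
    (hr : ρ (DihedralGroup.r 1) = rotate K k) (hs : ρ (DihedralGroup.sr 0) = dagger K k)
    (g : DihedralGroup (k + 1)) :
    ρ g ⟨magnusPoly K k, magnusPoly_mem_multilinear K k⟩ =
      ⟨magnusPoly K k, magnusPoly_mem_multilinear K k⟩ := by
  induction g using dihedralGroup_induction with
  | h1 => simp
  | hr =>
    rw [hr]
    exact Subtype.ext (by rw [rotate, LinearMap.coe_restrict_apply, rotateAux_magnusPoly])
  | hs =>
    rw [hs]
    exact Subtype.ext (by rw [dagger, LinearMap.coe_restrict_apply, daggerAux_magnusPoly])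
  | hmul g g' h h' => rw [map_mul, Module.End.mul_apply, h', h]

end LiePolynomial

end Magnus

theorem mainTheorem10 (K : Type*) [Field K] [CharZero K] (k : ℕ) [NeZero k] :
    -- reflection symmetry
    Magnus.magnus K (fun i : Fin k => FreeAlgebra.ι K i) =
        -Magnus.magnus K (fun i : Fin k => -FreeAlgebra.ι K i.rev) ∧
    -- cyclic symmetry, in the variables `X_0, …, X_k`
    Magnus.formalTrace K (Fin (k + 1))
        (FreeAlgebra.ι K 0 * Magnus.magnus K (fun i : Fin k => FreeAlgebra.ι K i.succ)) =
      Magnus.formalTrace K (Fin (k + 1))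
        (Magnus.magnus K (fun i : Fin k => FreeAlgebra.ι K i.castSucc) *
          FreeAlgebra.ι K (Fin.last k)) ∧
    -- multilinear Lie polynomials are determined by their commutator polynomials
    Function.Injective (Magnus.lieInclusion K k) ∧
    -- the dihedral actions on multilinear polynomials and multilinear Lie polynomials
    ∃ (ρ : Representation K (DihedralGroup (k + 1)) (Magnus.multilinear K k))
      (ρL : Representation K (DihedralGroup (k + 1)) (Magnus.lieMultilinear K k)),
      ρ (DihedralGroup.r 1) = Magnus.rotate K k ∧
      ρ (DihedralGroup.sr 0) = Magnus.dagger K k ∧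
      (∀ g x, Magnus.lieInclusion K k (ρL g x) = ρ g (Magnus.lieInclusion K k x)) ∧
      -- Lie monomials are permuted
      (∀ g (x : Magnus.lieMultilinear K k),
        (x : FreeLieAlgebra K (Fin k)) ∈ Magnus.lieMonomials K k →
          (ρL g x : FreeLieAlgebra K (Fin k)) ∈ Magnus.lieMonomials K k) ∧
      -- the Lie polynomial of the Magnus commutator exists and is invariant
      ∃ μLie : Magnus.lieMultilinear K k,
        (Magnus.lieInclusion K k μLie : FreeAlgebra K (Fin k)) =
          Magnus.magnus K (fun i : Fin k => FreeAlgebra.ι K i) ∧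
        ∀ g, ρL g μLie = μLie := by
  obtain ⟨ρ, hr, hs⟩ := Magnus.exists_dihedral_representation K (k := k)
  have hinj := Magnus.lieInclusion_injective K k
  obtain ⟨ρL, hρL⟩ := Magnus.exists_representation_of_injective ρ (Magnus.lieInclusion K k) hinj
    (Magnus.exists_lieInclusion_eq K hr hs)
  obtain ⟨μLie, hμ⟩ := Magnus.exists_lieInclusion_eq_magnusPoly K k
  refine ⟨Magnus.magnus_reflection K, Magnus.magnus_cyclic K, hinj, ρ, ρL, hr, hs, hρL, ?_, μLie,
    by rw [hμ, Magnus.magnus_ι], fun g => hinj ?_⟩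
  · intro g x hx
    obtain ⟨y, hy, he⟩ := Magnus.exists_lieMonomial K hr hs g x hx
    rw [← hρL] at he
    rwa [← hinj he]
  · have hμ' : Magnus.lieInclusion K k μLie =
        ⟨Magnus.magnusPoly K k, Magnus.magnusPoly_mem_multilinear K k⟩ := Subtype.ext hμ
    rw [hρL, hμ', Magnus.magnusPoly_invariant K hr hs]
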